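/- Let $\mathbb S\subset\mathbb R^2$, let $\|\cdot\|$ be the Euclidean norm, and let $X=(X(s))_{s\in\mathbb S}$ be a (jointly measurable) isotropic standard Gaussian process with auto-correlation function $\rho$: $X$ is a Gaussian process with $\mathbb E X(s)=0$, $\mathrm{Var}\,X(s)=1$ and $\mathrm{Cov}(X(s),X(t))=\rho(\|s-t\|)$ for all $s,t\in\mathbb S$. Fix a threshold $u\ge 0$, put $\mathcal D^+_{X,u}(s)=(X(s)-u)^+$, and for a region $\mathcal A\subset\mathbb S$ of Lebesgue measure $|\mathcal A|>0$ put $$L(\mathcal A,\mathcal D^+_{X,u})=\frac1{|\mathcal A|}\int_{\mathcal A}(X(s)-u)^+\,\mathrm ds .$$ Let $\mathcal G(h,u)=\mathrm{Cov}\big(\mathcal D^+_{X,u}(s),\mathcal D^+_{X,u}(t)\big)$ for $s,t\in\mathbb S$ with $\|s-t\|=h$. This does not depend on the choice of the pair $(s,t)$. Moreover, for every distance $h$ between two points of $\mathbb S$ with $|\rho(h)|<1$, $$\mathcal G(h,u)=\big(\rho(h)+u^2\big)\,\ell\big(u,u,\rho(h)\big)-2u\varphi(u)\overline\Phi\Big(\tfrac{u(1-\rho(h))}{(1-\rho^2(h))^{1/2}}\Big)+\big(1-\rho^2(h)\big)^{1/2}\varphi\Big(\tfrac{u}{(1+\rho(h))^{1/2}}\Big)^2-\big(\varphi(u)-u\overline\Phi(u)\big)^2,$$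 where $\varphi$ and $\overline\Phi$ are the density and the survival function of the standard normal law and $$\ell(u,v,w)=\frac{1}{2\pi(1-w^2)^{1/2}}\int_u^\infty\!\int_v^\infty e^{-\frac{1}{2(1-w^2)}(x^2-2wxy+y^2)}\,\mathrm dy\,\mathrm dx .$$ Then, for every $R>0$, the variance of $L(\mathcal A,\mathcal D^+_{X,u})$ reduces to a one-dimensional integral when $\mathcal A\subset\mathbb S$ is a (closed) disk or a (closed) square: (i) If $\mathcal A$ is a disk of radius $R$, then $$\mathrm{Var}\big(L(\mathcal A,\mathcal D^+_{X,u})\big)=\int_0^{2R}\mathcal G(h,u)\,f_{disk}(h,R)\,\mathrm dh,\qquad f_{disk}(h,R)=\frac{2h}{R^2}\Big(\frac2\pi\arccos\Big(\frac h{2R}\Big)-\frac h{\pi R}\sqrt{1-\frac{h^2}{4R^2}}\Big).$$ (ii) If $\mathcal A$ is a square of side $R$ (in any position), then $$\mathrm{Var}\big(L(\mathcal A,\mathcal D^+_{X,u})\big)=\int_0^{\sqrt2R}\mathcal G(h,u)\,f_{square}(h,R)\,\mathrm dh,$$ where $f_{square}(h,R)=\frac{2\pi h}{R^2}-\frac{8h^2}{R^3}+\frac{2h^3}{R^4}$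 for $h\in[0,R]$ and, for $h\in(R,\sqrt2R]$, with $b=h^2/R^2$, $$f_{square}(h,R)=\frac{2h}{R^2}\bigg[-2-b+3\sqrt{b-1}+\frac{b+1}{\sqrt{b-1}}+2\arcsin\Big(\frac{2-b}b\Big)-\frac{4}{b\sqrt{1-\frac{(2-b)^2}{b^2}}}\bigg].$$ In both cases all these quantities are well defined: the function $s\mapsto (X(s)-u)^+$ is almost surely integrable on $\mathcal A$, the variable $L(\mathcal A,\mathcal D^+_{X,u})$ is square integrable, and $h\mapsto\mathcal G(h,u)f(h,R)$ is integrable on the interval of integration. Moreover $f=f_{disk}(\cdot,R)$, resp. $f=f_{square}(\cdot,R)$, is nonnegative on $[0,2R]$, resp. $[0,\sqrt2R]$, and is there the probability density of the distance $\|S-T\|$ between two independent points $S,T$ uniformly distributed on $\mathcal A$. -/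

import Mathlib

open MeasureTheory ProbabilityTheory Set
open scoped Real

noncomputable section

/-- The Euclidean plane `ℝ²`. -/
abbrev Plane : Type := EuclideanSpace ℝ (Fin 2)

/-- Normalized aggregate loss `L(A, D) = |A|⁻¹ ∫_A D(s) ds`. -/
def normalizedLoss (A : Set Plane) (D : Plane → ℝ) : ℝ :=
  (volume.real A)⁻¹ * ∫ s in A, D s

/-- The excess damage function `D⁺_{X,u}(s) = (X(s) - u)⁺`, a random variable for each site `s`. -/
def excessDamage {Ω : Type*} (X : Plane → Ω → ℝ) (u : ℝ) (s : Plane) (ω : Ω) : ℝ :=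
  max (X s ω - u) 0

/-- The random variable `L(A, D⁺_{X,u})`. -/
def excessLoss {Ω : Type*} (X : Plane → Ω → ℝ) (u : ℝ) (A : Set Plane) (ω : Ω) : ℝ :=
  normalizedLoss A (fun s => excessDamage X u s ω)

/-- `(X(s))_{s ∈ S}` is an isotropic standard Gaussian process with auto-correlation function `ρ`:
a (jointly measurable) Gaussian process on `S` whose marginals have mean `0` and variance `1`
and for which `Cov(X(s), X(t)) = ρ(‖s - t‖)`. Values of `X` outside `S` play no role. -/
structure IsIsotropicStandardGaussian {Ω : Type*} [MeasurableSpace Ω] (P : Measure Ω)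
    (S : Set Plane) (X : Plane → Ω → ℝ) (ρ : ℝ → ℝ) : Prop where
  measurable : Measurable (fun p : S × Ω => X p.1 p.2)
  gaussian : IsGaussianProcess (fun s : S => X s) P
  mean_eq_zero : ∀ s ∈ S, ∫ ω, X s ω ∂P = 0
  variance_eq_one : ∀ s ∈ S, Var[X s; P] = 1
  covariance_eq : ∀ s ∈ S, ∀ t ∈ S, cov[X s, X t; P] = ρ (dist s t)

open Classical in
/-- `𝒢(h, u) = Cov(D⁺_{X,u}(s), D⁺_{X,u}(t))` for two sites `s, t ∈ S` at distance `h`.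
For an isotropic Gaussian process the choice of the pair is immaterial. If `S` holds no two
sites at distance `h`, the value is `0`. -/
def excessCov {Ω : Type*} [MeasurableSpace Ω] (P : Measure Ω) (S : Set Plane)
    (X : Plane → Ω → ℝ) (h u : ℝ) : ℝ :=
  if H : ∃ p : Plane × Plane, p.1 ∈ S ∧ p.2 ∈ S ∧ dist p.1 p.2 = h then
    cov[excessDamage X u H.choose.1, excessDamage X u H.choose.2; P]
  else 0

/-- The standard normal density `φ`. -/
def stdNormalDensity (x : ℝ) : ℝ := gaussianPDFReal 0 1 x

/-- The survival function of the standard normal law. -/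
def stdNormalSurvival (x : ℝ) : ℝ := (gaussianReal 0 1).real (Ioi x)

/-- `ℓ(u, v, w)`, the total probability of a truncated bivariate standard normal law with
correlation `w`. -/
def truncatedProb (u v w : ℝ) : ℝ :=
  1 / (2 * π * √(1 - w ^ 2)) *
    ∫ x in Ioi u, ∫ y in Ioi v,
      Real.exp (-1 / (2 * (1 - w ^ 2)) * (x ^ 2 - 2 * w * x * y + y ^ 2))

/-- The closed form of `𝒢`, as a function of the correlation `r = ρ(h)` (for `|r| < 1`). -/
def excessCovFormula (r u : ℝ) : ℝ :=
  (r + u ^ 2) * truncatedProb u u r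
    - 2 * u * stdNormalDensity u * stdNormalSurvival (u * (1 - r) / √(1 - r ^ 2))
    + √(1 - r ^ 2) * stdNormalDensity (u / √(1 + r)) ^ 2
    - (stdNormalDensity u - u * stdNormalSurvival u) ^ 2

/-- The set `A` is a (closed) square of side `R`, in any position of the plane: the image of
`[0, R]²` under a Euclidean isometry. -/
def IsSquareOfSide (A : Set Plane) (R : ℝ) : Prop :=
  ∃ φ : Plane ≃ᵢ Plane, A = φ '' {x | ∀ i, x i ∈ Icc 0 R}

/-- The law of `‖S - T‖` for `S`, `T` independent and uniformly distributed on `A`. -/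
def uniformDistanceLaw (A : Set Plane) : Measure ℝ :=
  ((cond volume A).prod (cond volume A)).map (fun p => dist p.1 p.2)

def fDisk (h R : ℝ) : ℝ :=
  2 * h / R ^ 2 *
    (2 / π * Real.arccos (h / (2 * R)) - h / (π * R) * √(1 - h ^ 2 / (4 * R ^ 2)))

/-- The second branch of `fSquare`, for `h ∈ [R, √2 R]`, with `b = h² / R²`. -/
def fSquareFar (h R b : ℝ) : ℝ :=
  2 * h / R ^ 2 *
    (-2 - b + 3 * √(b - 1) + (b + 1) / √(b - 1) + 2 * Real.arcsin ((2 - b) / b)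
      - 4 / (b * √(1 - (2 - b) ^ 2 / b ^ 2)))

def fSquare (h R : ℝ) : ℝ :=
  if h ≤ R then 2 * π * h / R ^ 2 - 8 * h ^ 2 / R ^ 3 + 2 * h ^ 3 / R ^ 4
  else fSquareFar h R (h ^ 2 / R ^ 2)

/-- On the region `A` the variance of the normalized excess loss reduces to
`Var(L(A, D⁺_{X,u})) = ∫_0^M 𝒢(h, u) f(h) dh`, where all quantities are well defined
(the loss is the integral of an almost surely integrable function and is square integrable,
and the right-hand integrand is integrable), and `f` on `[0, M]` is the density of the distance
between two independent uniform points of `A`. -/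
structure VarianceReducesTo {Ω : Type*} [MeasurableSpace Ω] (P : Measure Ω) (S : Set Plane)
    (X : Plane → Ω → ℝ) (u : ℝ) (A : Set Plane) (M : ℝ) (f : ℝ → ℝ) : Prop where
  integrable_path : ∀ᵐ ω ∂P, IntegrableOn (fun s => excessDamage X u s ω) A
  memLp_loss : MemLp (excessLoss X u A) 2 P
  integrable_rhs : IntervalIntegrable (fun h => excessCov P S X h u * f h) volume 0 M
  variance_eq : Var[excessLoss X u A; P] = ∫ h in (0 : ℝ)..M, excessCov P S X h u * f h
  nonneg : ∀ h ∈ Icc 0 M, 0 ≤ f h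
  density : uniformDistanceLaw A =
    (volume.restrict (Icc 0 M)).withDensity (fun h => ENNReal.ofReal (f h))

end

/-!
The argument has three independent parts.

*The covariance function.* If `(X, Y)` is a standard Gaussian pair with correlation `r`, then
`Y - r X` is uncorrelated with `X`, hence independent of it, so that the law of the pair is
`bivariateStdNormal r` (`map_prodMk_eq_bivariateStdNormal`). Covariances of excesses are therefore
functions of `ρ(‖s - t‖)` alone. For `|r| < 1` this law has the density `bivariateDensity r`, whose
partial derivatives are explicit linear multiples of itself; integrating by parts over the quadrant
`(u, ∞)²` gives linear equations for its moments of order at most two, and solving them yields the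
closed form (`integral_excess_mul_excess`).

*Reduction of the variance.* The loss is an average of the random field over the uniform law `ν` of
the region. By Fubini its variance is the average of the covariances over `ν ⊗ ν`
(`variance_average`); since the covariance is a function of the distance, this is an integral
against the law of the distance of two uniform points. No regularity of `ρ` is assumed: the
measurability of `𝒢` on `[0, M]` comes from joint measurability of the field, by evaluating the
covariance on pairs of sites that run along a segment of length `M` in the region
(`IsIsotropicStandardGaussian.varianceReducesTo`).

*The distance law.* The plane is identified with `ℂ`. The difference of two uniform points of `B`
has a density proportional to the area of the overlap of `B` with its translate, and polar
coordinates give the density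
`h / |B|² ∫ |B ∩ (B - h e^{iθ})| dθ` for the distance (`uniformDistanceLaw_eq_withDensity`). For a
disk the overlap is a lens, whose area does not depend on `θ`; for a square of side `R` it is a
rectangle with sides `(R - h |cos θ|)⁺` and `(R - h |sin θ|)⁺`.
-/

/-! ### The bivariate standard normal law -/

/-- The standard bivariate normal law with correlation `r`, for `|r| ≤ 1`: the law of
`(x, r x + w)` for independent `x ∼ N(0, 1)` and `w ∼ N(0, 1 - r²)`. The degenerate cases
`r = ±1` are included. -/
noncomputable def bivariateStdNormal (r : ℝ) : Measure (ℝ × ℝ) :=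
  ((gaussianReal 0 1).prod (gaussianReal 0 (1 - r ^ 2).toNNReal)).map
    (fun p => (p.1, r * p.1 + p.2))

instance (r : ℝ) : IsProbabilityMeasure (bivariateStdNormal r) :=
  Measure.isProbabilityMeasure_map (by fun_prop)

/-- Subtracting from `Y` its projection `r X` leaves an uncorrelated, hence independent, Gaussian
variable. -/
theorem map_prodMk_eq_bivariateStdNormal {Ω : Type*} [MeasurableSpace Ω]
    {P : Measure Ω} {X Y : Ω → ℝ} {r : ℝ} (h : HasGaussianLaw (fun ω => (X ω, Y ω)) P)
    (hX0 : ∫ ω, X ω ∂P = 0) (hY0 : ∫ ω, Y ω ∂P = 0) (hX1 : Var[X; P] = 1) (hY1 : Var[Y; P] = 1)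
    (hr : cov[X, Y; P] = r) :
    P.map (fun ω => (X ω, Y ω)) = bivariateStdNormal r := by
  have := h.isProbabilityMeasure
  have hX := h.fst
  have hY := h.snd
  set W : Ω → ℝ := fun ω => Y ω - r * X ω with hW
  have hXW : HasGaussianLaw (fun ω => (X ω, W ω)) P :=
    h.map_fun ((ContinuousLinearMap.fst ℝ ℝ ℝ).prod
      (ContinuousLinearMap.snd ℝ ℝ ℝ - r • ContinuousLinearMap.fst ℝ ℝ ℝ))
  have hrX : MemLp (fun ω => r * X ω) 2 P := hX.memLp_two.const_mul r
  have hcov : cov[X, W; P] = 0 := by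
    rw [hW, covariance_fun_sub_right hX.memLp_two hY.memLp_two hrX, covariance_const_mul_right, hr,
      covariance_self hX.aemeasurable, hX1]
    ring
  have hWvar : Var[W; P] = 1 - r ^ 2 := by
    rw [hW, variance_fun_sub hY.memLp_two hrX, covariance_const_mul_right, covariance_comm, hr,
      variance_const_mul, hX1, hY1]
    ring
  have hW0 : ∫ ω, W ω ∂P = 0 := by
    rw [hW, integral_sub hY.integrable (hX.integrable.const_mul r), integral_const_mul, hX0, hY0]
    simp
  have hind := (indepFun_iff_map_prod_eq_prod_map_map hX.aemeasurable
    hXW.snd.aemeasurable).1 (hXW.indepFun_of_covariance_eq_zero hcov)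
  rw [hX.map_eq_gaussianReal, hXW.snd.map_eq_gaussianReal, hX0, hX1, hW0, hWvar,
    Real.toNNReal_one] at hind
  rw [bivariateStdNormal, ← hind, AEMeasurable.map_map_of_aemeasurable (by fun_prop)
    hXW.aemeasurable]
  congr 1
  ext ω <;> simp [hW]

/-- The bivariate standard normal density with correlation `r`. -/
noncomputable def bivariateDensity (r x y : ℝ) : ℝ :=
  1 / (2 * π * √(1 - r ^ 2)) * Real.exp (-1 / (2 * (1 - r ^ 2)) * (x ^ 2 - 2 * r * x * y + y ^ 2))

theorem bivariateDensity_comm (r x y : ℝ) : bivariateDensity r x y = bivariateDensity r y x := by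
  unfold bivariateDensity; congr 3; ring

theorem bivariateDensity_nonneg (r x y : ℝ) : 0 ≤ bivariateDensity r x y := by
  unfold bivariateDensity; positivity

theorem continuous_bivariateDensity (r : ℝ) :
    Continuous (fun p : ℝ × ℝ => bivariateDensity r p.1 p.2) := by
  unfold bivariateDensity; fun_prop

theorem one_sub_sq_pos {r : ℝ} (hr : |r| < 1) : 0 < 1 - r ^ 2 := by
  have := (sq_lt_one_iff_abs_lt_one r).2 hr
  linarith

theorem coe_toNNReal_one_sub_sq {r : ℝ} (hr : |r| < 1) :
    ((1 - r ^ 2).toNNReal : ℝ) = 1 - r ^ 2 := Real.coe_toNNReal _ (one_sub_sq_pos hr).le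

/-- Conditionally on the first coordinate `x`, the second one is `N(r x, 1 - r²)`. -/
theorem bivariateDensity_eq {r : ℝ} (hr : |r| < 1) (x y : ℝ) :
    bivariateDensity r x y
      = gaussianPDFReal 0 1 x * gaussianPDFReal (r * x) (1 - r ^ 2).toNNReal y := by
  have hq := one_sub_sq_pos hr
  have h1 : √(2 * π) * √(2 * π) = 2 * π := Real.mul_self_sqrt (by positivity)
  simp only [gaussianPDFReal, coe_toNNReal_one_sub_sq hr, NNReal.coe_one, bivariateDensity]
  rw [mul_mul_mul_comm, ← Real.exp_add, Real.sqrt_mul (by positivity) (1 - r ^ 2), mul_one,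
    ← mul_inv, ← mul_assoc, h1, one_div]
  congr 2
  field_simp
  ring

theorem bivariateStdNormal_eq_withDensity {r : ℝ} (hr : |r| < 1) :
    bivariateStdNormal r
      = volume.withDensity (fun p => ENNReal.ofReal (bivariateDensity r p.1 p.2)) := by
  have hq : (1 - r ^ 2).toNNReal ≠ 0 := by simpa using one_sub_sq_pos hr
  refine Measure.ext_of_lintegral _ fun f hf => ?_
  have hd : Measurable fun p : ℝ × ℝ => ENNReal.ofReal (bivariateDensity r p.1 p.2) :=
    (continuous_bivariateDensity r).measurable.ennreal_ofReal
  rw [bivariateStdNormal, lintegral_map hf (by fun_prop), lintegral_withDensity_eq_lintegral_mul _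
    hd hf, Measure.volume_eq_prod, lintegral_prod _ (hd.mul hf).aemeasurable, lintegral_prod]
  · rw [gaussianReal_of_var_ne_zero 0 one_ne_zero, gaussianReal_of_var_ne_zero 0 hq,
      lintegral_withDensity_eq_lintegral_mul _ (measurable_gaussianPDF _ _)]
    · refine lintegral_congr fun x => ?_
      simp only [Pi.mul_apply]
      rw [lintegral_withDensity_eq_lintegral_mul _ (measurable_gaussianPDF _ _) (by fun_prop),
        ← lintegral_const_mul _ (by fun_prop)]
      conv_rhs => rw [← lintegral_add_left_eq_self _ (r * x)]
      refine lintegral_congr fun w => ?_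
      simp only [Pi.mul_apply, gaussianPDF]
      rw [bivariateDensity_eq hr, ENNReal.ofReal_mul (gaussianPDFReal_nonneg _ _ _), mul_assoc]
      congr 3
      simp [gaussianPDFReal]
    · exact Measurable.lintegral_prod_right' (f := fun p : ℝ × ℝ => f (p.1, r * p.1 + p.2))
        (by fun_prop)
  · fun_prop

theorem map_fst_bivariateStdNormal (r : ℝ) :
    (bivariateStdNormal r).map Prod.fst = gaussianReal 0 1 := by
  rw [bivariateStdNormal, Measure.map_map measurable_fst (by fun_prop)]
  exact Measure.fst_prod

theorem memLp_fst_bivariateStdNormal (r : ℝ) :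
    MemLp (fun p : ℝ × ℝ => p.1) 2 (bivariateStdNormal r) := by
  have := memLp_id_gaussianReal (μ := 0) (v := 1) 2
  rw [← map_fst_bivariateStdNormal r] at this
  exact this.comp_of_map (by fun_prop)

theorem memLp_snd_bivariateStdNormal (r : ℝ) :
    MemLp (fun p : ℝ × ℝ => p.2) 2 (bivariateStdNormal r) := by
  rw [bivariateStdNormal, memLp_map_measure_iff (by fun_prop) (by fun_prop)]
  exact (((memLp_id_gaussianReal 2).comp_fst _).const_mul r).add
    ((memLp_id_gaussianReal 2).comp_snd _)

/-- Moments of order at most two are integrable against the density. -/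
theorem integrable_mul_bivariateDensity {r : ℝ} (hr : |r| < 1) {f : ℝ × ℝ → ℝ}
    (hf : Integrable f (bivariateStdNormal r)) :
    Integrable (fun p : ℝ × ℝ => f p * bivariateDensity r p.1 p.2) (volume.prod volume) := by
  rw [bivariateStdNormal_eq_withDensity hr, integrable_withDensity_iff_integrable_smul'
    (continuous_bivariateDensity r).measurable.ennreal_ofReal (by simp)] at hf
  refine hf.congr (.of_forall fun p => ?_)
  simp [ENNReal.toReal_ofReal (bivariateDensity_nonneg r p.1 p.2), mul_comm]

theorem integral_bivariateStdNormal {r : ℝ} (hr : |r| < 1) (f : ℝ × ℝ → ℝ) :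
    ∫ p, f p ∂bivariateStdNormal r = ∫ p : ℝ × ℝ, f p * bivariateDensity r p.1 p.2 := by
  rw [bivariateStdNormal_eq_withDensity hr, integral_withDensity_eq_integral_toReal_smul
    (continuous_bivariateDensity r).measurable.ennreal_ofReal (by simp)]
  congr with p
  simp [ENNReal.toReal_ofReal (bivariateDensity_nonneg r p.1 p.2), mul_comm]

theorem integrable_mul_gaussianPDFReal {m : ℝ} {v : NNReal} (hv : v ≠ 0) {f : ℝ → ℝ}
    (hf : Integrable f (gaussianReal m v)) : Integrable (fun x => f x * gaussianPDFReal m v x) := by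
  rw [gaussianReal_of_var_ne_zero m hv, integrable_withDensity_iff_integrable_smul'
    (measurable_gaussianPDF _ _) (.of_forall fun x => gaussianPDF_lt_top)] at hf
  refine hf.congr (.of_forall fun p => ?_)
  simp [toReal_gaussianPDF, mul_comm]

theorem integrable_mul_bivariateDensity_right {r : ℝ} (hr : |r| < 1) (x : ℝ) {f : ℝ → ℝ}
    (hf : Integrable f (gaussianReal (r * x) (1 - r ^ 2).toNNReal)) :
    Integrable (fun y => f y * bivariateDensity r x y) := by
  have hq : (1 - r ^ 2).toNNReal ≠ 0 := by simpa using one_sub_sq_pos hr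
  refine ((integrable_mul_gaussianPDFReal hq hf).const_mul (gaussianPDFReal 0 1 x)).congr
    (.of_forall fun y => ?_)
  simp only [bivariateDensity_eq hr]
  ring

theorem integrable_id_gaussianReal (m : ℝ) (v : NNReal) :
    Integrable (fun x => x) (gaussianReal m v) :=
  memLp_one_iff_integrable.1 (memLp_id_gaussianReal 1)

theorem integrable_sq_gaussianReal (m : ℝ) (v : NNReal) :
    Integrable (fun x => x ^ 2) (gaussianReal m v) :=
  (memLp_id_gaussianReal (μ := m) (v := v) 2).integrable_sq

/-- The fundamental theorem of calculus on a half-line for an integrable function with integrable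
derivative: the boundary term at infinity vanishes. -/
theorem integral_Ioi_deriv_of_integrable {f f' : ℝ → ℝ} (u : ℝ) (hd : ∀ x, HasDerivAt f (f' x) x)
    (hf : Integrable f) (hf' : Integrable f') : ∫ x in Ioi u, f' x = -f u := by
  rw [integral_Ioi_of_hasDerivAt_of_tendsto (hd u).continuousAt.continuousWithinAt
    (fun x _ => hd x) hf'.integrableOn (tendsto_zero_of_hasDerivAt_of_integrableOn_Ioi (a := u)
    (fun x _ => hd x) hf'.integrableOn hf.integrableOn), zero_sub]

theorem hasDerivAt_bivariateDensity {r : ℝ} (hr : |r| < 1) (x y : ℝ) :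
    HasDerivAt (bivariateDensity r x)
      (-((y - r * x) / (1 - r ^ 2) * bivariateDensity r x y)) y := by
  have hq := (one_sub_sq_pos hr).ne'
  have h1 : HasDerivAt (fun y => -1 / (2 * (1 - r ^ 2)) * (x ^ 2 - 2 * r * x * y + y ^ 2))
      (-1 / (2 * (1 - r ^ 2)) * (-(2 * r * x) + 2 * y)) y := by
    have := (((hasDerivAt_id y).const_mul (2 * r * x)).const_sub (x ^ 2)).add
      ((hasDerivAt_id y).pow 2)
    simpa using this.const_mul (-1 / (2 * (1 - r ^ 2)))
  convert! h1.exp.const_mul (1 / (2 * π * √(1 - r ^ 2))) using 1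
  unfold bivariateDensity
  field_simp
  ring

theorem integral_Ioi_sub_mul_bivariateDensity {r : ℝ} (hr : |r| < 1) (u x : ℝ) :
    ∫ y in Ioi u, (y - r * x) * bivariateDensity r x y
      = (1 - r ^ 2) * bivariateDensity r x u := by
  have hq := (one_sub_sq_pos hr).ne'
  have h := integral_Ioi_deriv_of_integrable u
    (fun y => (hasDerivAt_bivariateDensity hr x y).const_mul (-(1 - r ^ 2)))
    (((integrable_mul_bivariateDensity_right hr x (f := fun _ => 1) (integrable_const _)).const_mul
      (-(1 - r ^ 2))).congr (.of_forall fun y => by simp))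
    ((integrable_mul_bivariateDensity_right hr x ((integrable_id_gaussianReal _ _).sub
      (integrable_const (r * x)))).congr (.of_forall fun y => by simp; field_simp; ring))
  rw [neg_mul, neg_neg] at h
  rw [← h]
  congr with y
  field_simp

theorem integral_Ioi_mul_sub_mul_bivariateDensity {r : ℝ} (hr : |r| < 1) (u x : ℝ) :
    ∫ y in Ioi u, (y * (y - r * x) - (1 - r ^ 2)) * bivariateDensity r x y
      = (1 - r ^ 2) * u * bivariateDensity r x u := by
  have hq := (one_sub_sq_pos hr).ne'
  have h := integral_Ioi_deriv_of_integrable u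
    (fun y => ((hasDerivAt_id y).mul (hasDerivAt_bivariateDensity hr x y)).const_mul (-(1 - r ^ 2)))
    (((integrable_mul_bivariateDensity_right hr x (integrable_id_gaussianReal _ _)).const_mul
      (-(1 - r ^ 2))).congr (.of_forall fun y => by simp))
    ((integrable_mul_bivariateDensity_right hr x (((integrable_sq_gaussianReal _ _).sub
      ((integrable_id_gaussianReal _ _).const_mul (r * x))).sub
      (integrable_const (1 - r ^ 2)))).congr (.of_forall fun y => by simp; field_simp; ring))
  simp only [Pi.mul_apply, id, neg_mul, neg_neg] at h
  rw [mul_assoc, ← h]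
  congr with y
  field_simp
  ring

/-- The mass that the density puts on the half-line `{u} × (u, ∞)`. -/
theorem integral_Ioi_bivariateDensity {r : ℝ} (hr : |r| < 1) (u : ℝ) :
    ∫ y in Ioi u, bivariateDensity r u y
      = stdNormalDensity u * stdNormalSurvival (u * (1 - r) / √(1 - r ^ 2)) := by
  have hq := one_sub_sq_pos hr
  have hq' : (1 - r ^ 2).toNNReal ≠ 0 := by simpa using hq
  simp_rw [bivariateDensity_eq hr, integral_const_mul, stdNormalDensity, stdNormalSurvival]
  congr 1
  have h : gaussianReal (r * u) (1 - r ^ 2).toNNReal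
      = (gaussianReal 0 1).map (fun x => √(1 - r ^ 2) * x + r * u) := by
    have : (fun x => √(1 - r ^ 2) * x + r * u) = (· + r * u) ∘ (√(1 - r ^ 2) * ·) := rfl
    rw [this, ← Measure.map_map (by fun_prop) (by fun_prop), gaussianReal_map_const_mul,
      gaussianReal_map_add_const]
    congr 1
    · simp
    · ext; simp [Real.sq_sqrt hq.le, hq.le]
  have h2 := gaussianReal_apply_eq_integral (r * u) hq' (Ioi u)
  rw [← ENNReal.toReal_ofReal (integral_nonneg fun y => gaussianPDFReal_nonneg _ _ y), ← h2, h,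
    Measure.map_apply (by fun_prop) measurableSet_Ioi, measureReal_def]
  congr 2
  ext x
  simp only [mem_preimage, mem_Ioi, div_lt_iff₀ (Real.sqrt_pos.2 hq)]
  constructor <;> intro <;> nlinarith

theorem integral_excess_gaussianReal (u : ℝ) :
    ∫ x, max (x - u) 0 ∂gaussianReal 0 1 = stdNormalDensity u - u * stdNormalSurvival u := by
  have hd : ∀ x, HasDerivAt (fun x => -gaussianPDFReal 0 1 x) (x * gaussianPDFReal 0 1 x) x := by
    intro x
    have h1 : HasDerivAt (fun x : ℝ => -(x - 0) ^ 2 / (2 * (1 : NNReal))) (-x) x := by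
      convert! ((((hasDerivAt_id x).sub_const 0).pow 2).neg).div_const (2 * (1 : NNReal)) using 1
      simp
      ring
    convert! (h1.exp.const_mul ((√(2 * π * (1 : NNReal)))⁻¹)).neg using 1
    simp only [gaussianPDFReal]
    ring
  have h1 := integral_Ioi_deriv_of_integrable u hd (integrable_gaussianPDFReal 0 1).neg
    (integrable_mul_gaussianPDFReal one_ne_zero (integrable_id_gaussianReal 0 1))
  have h2 := gaussianReal_apply_eq_integral 0 one_ne_zero (Ioi u)
  rw [integral_gaussianReal_eq_integral_smul one_ne_zero, stdNormalDensity, stdNormalSurvival,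
    measureReal_def, h2,
    ENNReal.toReal_ofReal (integral_nonneg fun y => gaussianPDFReal_nonneg _ _ y)]
  rw [neg_neg] at h1
  rw [← h1, ← integral_const_mul, ← integral_sub
    (integrable_mul_gaussianPDFReal one_ne_zero (integrable_id_gaussianReal 0 1)).integrableOn
    ((integrable_gaussianPDFReal 0 1).const_mul u).integrableOn, ← integral_indicator
    measurableSet_Ioi]
  congr with x
  by_cases hx : u < x
  · simp only [indicator, mem_Ioi, hx, if_true, smul_eq_mul, max_eq_left (sub_nonneg.2 hx.le)]
    ring
  · simp [indicator, hx, max_eq_right (sub_nonpos.2 (not_lt.1 hx))]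

/-! ### Second moment of the excesses of a Gaussian pair -/

/-- The integral of `f` against the bivariate density over the quadrant `(u, ∞)²`. -/
noncomputable def quadrantMoment (r u : ℝ) (f : ℝ × ℝ → ℝ) : ℝ :=
  ∫ p in Ioi u ×ˢ Ioi u, f p * bivariateDensity r p.1 p.2

theorem quadrantMoment_add {r : ℝ} (hr : |r| < 1) (u : ℝ) {f g : ℝ × ℝ → ℝ}
    (hf : Integrable f (bivariateStdNormal r)) (hg : Integrable g (bivariateStdNormal r)) :
    quadrantMoment r u (fun p => f p + g p) = quadrantMoment r u f + quadrantMoment r u g := by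
  simp_rw [quadrantMoment, add_mul]
  exact integral_add (integrable_mul_bivariateDensity hr hf).integrableOn
    (integrable_mul_bivariateDensity hr hg).integrableOn

theorem quadrantMoment_const_mul (r u c : ℝ) (f : ℝ × ℝ → ℝ) :
    quadrantMoment r u (fun p => c * f p) = c * quadrantMoment r u f := by
  simp_rw [quadrantMoment, mul_assoc, integral_const_mul]

theorem quadrantMoment_swap (r u : ℝ) (f : ℝ × ℝ → ℝ) :
    quadrantMoment r u (fun p => f p.swap) = quadrantMoment r u f := by
  rw [quadrantMoment, quadrantMoment, Measure.volume_eq_prod,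
    ← setIntegral_prod_swap (Ioi u) (Ioi u) (fun p => f p * bivariateDensity r p.1 p.2)]
  simp [bivariateDensity_comm r]

theorem quadrantMoment_eq_iterated {r : ℝ} (hr : |r| < 1) (u : ℝ) {f : ℝ × ℝ → ℝ}
    (hf : Integrable f (bivariateStdNormal r)) :
    quadrantMoment r u f
      = ∫ x in Ioi u, ∫ y in Ioi u, f (x, y) * bivariateDensity r x y := by
  rw [quadrantMoment, Measure.volume_eq_prod,
    setIntegral_prod _ (integrable_mul_bivariateDensity hr hf).integrableOn]

/-- The second moment of the excesses over `u` of a standard bivariate normal pair. Integration by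
parts in one variable gives linear equations for the moments of order at most two over the quadrant
`(u, ∞)²`, with boundary terms on the half-line `{u} × (u, ∞)`; these equations determine them. -/
theorem integral_excess_mul_excess {r : ℝ} (hr : |r| < 1) (u : ℝ) :
    ∫ p, max (p.1 - u) 0 * max (p.2 - u) 0 ∂bivariateStdNormal r
      = (r + u ^ 2) * truncatedProb u u r
        - 2 * u * stdNormalDensity u * stdNormalSurvival (u * (1 - r) / √(1 - r ^ 2))
        + √(1 - r ^ 2) * stdNormalDensity (u / √(1 + r)) ^ 2 := by
  have hq := one_sub_sq_pos hr
  have hr1 : 0 < 1 + r := by linarith [(abs_lt.1 hr).1]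
  have hr2 : 0 < 1 - r := by linarith [(abs_lt.1 hr).2]
  set μ := bivariateStdNormal r
  have i1 : Integrable (fun p : ℝ × ℝ => p.1) μ :=
    (memLp_fst_bivariateStdNormal r).integrable one_le_two
  have i2 : Integrable (fun p : ℝ × ℝ => p.2) μ :=
    (memLp_snd_bivariateStdNormal r).integrable one_le_two
  have i11 : Integrable (fun p : ℝ × ℝ => p.1 ^ 2) μ :=
    (memLp_fst_bivariateStdNormal r).integrable_sq
  have i22 : Integrable (fun p : ℝ × ℝ => p.2 ^ 2) μ :=
    (memLp_snd_bivariateStdNormal r).integrable_sq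
  have i12 : Integrable (fun p : ℝ × ℝ => p.1 * p.2) μ :=
    (memLp_fst_bivariateStdNormal r).integrable_mul (memLp_snd_bivariateStdNormal r)
  have i0 : Integrable (fun _ : ℝ × ℝ => (1 : ℝ)) μ := integrable_const 1
  set K := stdNormalDensity u * stdNormalSurvival (u * (1 - r) / √(1 - r ^ 2)) with hK
  have hK' : ∫ x in Ioi u, bivariateDensity r x u = K := by
    rw [hK, ← integral_Ioi_bivariateDensity hr]
    simp_rw [bivariateDensity_comm r _ u]
  set D := bivariateDensity r u u with hD
  have hm0 : quadrantMoment r u (fun _ => 1) = truncatedProb u u r := by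
    rw [quadrantMoment_eq_iterated hr u i0]
    simp_rw [one_mul, truncatedProb, bivariateDensity, integral_const_mul]
  set ℓ := truncatedProb u u r
  -- The moments of `y - r x`, of `y (y - r x) - (1 - r²)` and of `x (y - r x)`, each from an
  -- integration by parts in `y`.
  have e1 : quadrantMoment r u (fun p => p.2 + -r * p.1) = (1 - r ^ 2) * K := by
    rw [quadrantMoment_eq_iterated hr u (i2.fun_add (i1.const_mul (-r)))]
    simp_rw [neg_mul, ← sub_eq_add_neg, integral_Ioi_sub_mul_bivariateDensity hr u,
      integral_const_mul, hK']
  have e2 : quadrantMoment r u (fun p => p.2 ^ 2 + (-r * (p.1 * p.2) + -(1 - r ^ 2) * 1))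
      = (1 - r ^ 2) * u * K := by
    rw [quadrantMoment_eq_iterated hr u
      (i22.fun_add ((i12.const_mul (-r)).fun_add (i0.const_mul (-(1 - r ^ 2))))), ← hK',
      ← integral_const_mul]
    congr with x
    rw [← integral_Ioi_mul_sub_mul_bivariateDensity hr u]
    congr with y
    ring
  have hx : ∫ x in Ioi u, x * bivariateDensity r u x = (1 - r ^ 2) * D + r * u * K := by
    have h := integral_Ioi_sub_mul_bivariateDensity hr u u
    simp_rw [sub_mul] at h
    rw [integral_sub
      (integrable_mul_bivariateDensity_right hr u (integrable_id_gaussianReal _ _)).integrableOn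
      (integrable_mul_bivariateDensity_right hr u (integrable_const (r * u))).integrableOn,
      integral_const_mul, integral_Ioi_bivariateDensity hr] at h
    linarith
  have e3 : quadrantMoment r u (fun p => p.1 * p.2 + -r * p.1 ^ 2)
      = (1 - r ^ 2) * ((1 - r ^ 2) * D + r * u * K) := by
    rw [quadrantMoment_eq_iterated hr u (i12.fun_add (i11.const_mul (-r))), ← hx,
      ← integral_const_mul]
    congr with x
    rw [bivariateDensity_comm r u x, mul_left_comm, ← integral_Ioi_sub_mul_bivariateDensity hr u,
      ← integral_const_mul]
    congr with y
    ring
  have s1 : quadrantMoment r u (fun p => p.2) = quadrantMoment r u (fun p => p.1) :=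
    quadrantMoment_swap r u (fun p => p.1)
  have s2 : quadrantMoment r u (fun p => p.2 ^ 2) = quadrantMoment r u (fun p => p.1 ^ 2) :=
    quadrantMoment_swap r u (fun p => p.1 ^ 2)
  rw [quadrantMoment_add hr u i2 (i1.const_mul (-r)), quadrantMoment_const_mul, s1] at e1
  rw [quadrantMoment_add hr u i22 ((i12.const_mul (-r)).fun_add (i0.const_mul (-(1 - r ^ 2)))),
    quadrantMoment_add hr u (i12.const_mul (-r)) (i0.const_mul (-(1 - r ^ 2))),
    quadrantMoment_const_mul, quadrantMoment_const_mul, hm0, s2] at e2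
  rw [quadrantMoment_add hr u i12 (i11.const_mul (-r)), quadrantMoment_const_mul] at e3
  have hint : ∫ p, max (p.1 - u) 0 * max (p.2 - u) 0 ∂μ
      = quadrantMoment r u (fun p => p.1 * p.2 + (-u * p.1 + (-u * p.2 + u ^ 2 * 1))) := by
    rw [integral_bivariateStdNormal hr, quadrantMoment,
      ← integral_indicator (measurableSet_Ioi.prod measurableSet_Ioi)]
    congr with p
    by_cases hp : p ∈ Ioi u ×ˢ Ioi u
    · rw [indicator_of_mem hp, max_eq_left (sub_nonneg.2 (le_of_lt hp.1)),
        max_eq_left (sub_nonneg.2 (le_of_lt hp.2))]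
      ring
    · rw [indicator_of_notMem hp]
      rcases not_and_or.1 hp with h | h
      · simp [max_eq_right (sub_nonpos.2 (show p.1 ≤ u from not_lt.1 h))]
      · simp [max_eq_right (sub_nonpos.2 (show p.2 ≤ u from not_lt.1 h))]
  rw [hint, quadrantMoment_add hr u i12 ((i1.const_mul (-u)).fun_add ((i2.const_mul (-u)).fun_add
    (i0.const_mul (u ^ 2)))), quadrantMoment_add hr u (i1.const_mul (-u))
    ((i2.const_mul (-u)).fun_add
    (i0.const_mul (u ^ 2))), quadrantMoment_add hr u (i2.const_mul (-u)) (i0.const_mul (u ^ 2)),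
    quadrantMoment_const_mul, quadrantMoment_const_mul, quadrantMoment_const_mul, hm0, s1]
  have hDφ : √(1 - r ^ 2) * stdNormalDensity (u / √(1 + r)) ^ 2 = (1 - r ^ 2) * D := by
    have h1 : √(2 * π) * √(2 * π) = 2 * π := Real.mul_self_sqrt (by positivity)
    have h2 : √(1 - r ^ 2) * √(1 - r ^ 2) = 1 - r ^ 2 := Real.mul_self_sqrt hq.le
    have h3 : √(1 + r) ^ 2 = 1 + r := Real.sq_sqrt hr1.le
    have h4 : √(1 - r ^ 2) ≠ 0 := (Real.sqrt_pos.2 hq).ne'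
    have h5 : 2 * (-(u / √(1 + r) - 0) ^ 2 / (2 * 1))
        = -1 / (2 * (1 - r ^ 2)) * (u ^ 2 - 2 * r * u * u + u ^ 2) := by
      rw [sub_zero, div_pow, h3, show 1 - r ^ 2 = (1 - r) * (1 + r) by ring]
      field_simp
      ring
    rw [hD, bivariateDensity, stdNormalDensity, gaussianPDFReal, NNReal.coe_one, mul_pow,
      ← Real.exp_nat_mul, Nat.cast_ofNat, h5, mul_one, inv_pow, sq √(2 * π), h1, ← mul_assoc,
      ← mul_assoc]
    congr 1
    field_simp
    rw [sq, h2]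
  rw [hDφ]
  set m1 := quadrantMoment r u (fun p => p.1)
  set a := quadrantMoment r u (fun p => p.1 * p.2)
  set b := quadrantMoment r u (fun p => p.1 ^ 2)
  have hm1 : m1 = (1 + r) * K := by
    apply mul_left_cancel₀ hr2.ne'
    linarith
  have ha : a = (1 - r ^ 2) * D + 2 * r * u * K + r * ℓ := by
    apply mul_left_cancel₀ hq.ne'
    linear_combination e3 + r * e2
  rw [hm1, ha, mul_assoc (2 * u), ← hK]
  ring

/-! ### Variance of the average of a random field -/

section Averages

variable {E Ω : Type*} [MeasurableSpace E] [MeasurableSpace Ω] {ν : Measure E} {P : Measure Ω}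
  {D : E → Ω → ℝ}

theorem memLp_uncurry_of_integral_sq_le [IsProbabilityMeasure ν] [IsProbabilityMeasure P]
    (hD : Measurable (Function.uncurry D)) {C : ℝ}
    (h2 : ∀ᵐ s ∂ν, MemLp (D s) 2 P) (hC : ∀ᵐ s ∂ν, ∫ ω, D s ω ^ 2 ∂P ≤ C) :
    MemLp (Function.uncurry D) 2 (ν.prod P) := by
  rw [memLp_two_iff_integrable_sq hD.aestronglyMeasurable,
    integrable_prod_iff (hD.pow_const 2).aestronglyMeasurable]
  refine ⟨h2.mono fun s hs => hs.integrable_sq, Integrable.of_bound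
    (hD.pow_const 2).norm.stronglyMeasurable.integral_prod_right.aestronglyMeasurable C
    (hC.mono fun s hs => ?_)⟩
  rw [Real.norm_of_nonneg (integral_nonneg fun _ => norm_nonneg _)]
  simpa using hs

theorem stronglyMeasurable_covariance [SFinite P]
    (hD : Measurable (Function.uncurry D)) :
    StronglyMeasurable (fun p : E × E => cov[D p.1, D p.2; P]) := by
  have hm : Measurable (fun s => ∫ ω, D s ω ∂P) :=
    (hD.stronglyMeasurable.integral_prod_right (ν := P)).measurable
  have h1 : Measurable (fun q : (E × E) × Ω => D q.1.1 q.2) :=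
    hD.comp ((measurable_fst.comp measurable_fst).prodMk measurable_snd)
  have h2 : Measurable (fun q : (E × E) × Ω => D q.1.2 q.2) :=
    hD.comp ((measurable_snd.comp measurable_fst).prodMk measurable_snd)
  unfold covariance
  exact (((h1.sub (hm.comp (measurable_fst.comp measurable_fst))).mul
    (h2.sub (hm.comp (measurable_snd.comp measurable_fst)))).stronglyMeasurable).integral_prod_right

theorem ae_integrable_of_memLp_uncurry [IsProbabilityMeasure ν] [IsProbabilityMeasure P]
    (hD : MemLp (Function.uncurry D) 2 (ν.prod P)) :
    ∀ᵐ ω ∂P, Integrable (fun s => D s ω) ν :=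
  (hD.integrable one_le_two).prod_left_ae

/-- The products whose integral over `ν ⊗ ν` is the square of the average. -/
theorem integrable_mul_of_memLp_uncurry [IsProbabilityMeasure ν] [IsProbabilityMeasure P]
    (hD : MemLp (Function.uncurry D) 2 (ν.prod P)) :
    Integrable (fun q : (E × E) × Ω => D q.1.1 q.2 * D q.1.2 q.2) ((ν.prod ν).prod P) := by
  have h1 : MemLp (fun q : (E × E) × Ω => D q.1.1 q.2) 2 ((ν.prod ν).prod P) :=
    hD.comp_measurePreserving (measurePreserving_fst.prod (MeasurePreserving.id P))
  have h2 : MemLp (fun q : (E × E) × Ω => D q.1.2 q.2) 2 ((ν.prod ν).prod P) :=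
    hD.comp_measurePreserving (measurePreserving_snd.prod (MeasurePreserving.id P))
  exact h1.integrable_mul h2

theorem memLp_average [IsProbabilityMeasure ν] [IsProbabilityMeasure P]
    (hD : MemLp (Function.uncurry D) 2 (ν.prod P)) :
    MemLp (fun ω => ∫ s, D s ω ∂ν) 2 P := by
  have hm : AEStronglyMeasurable (fun ω => ∫ s, D s ω ∂ν) P :=
    hD.aestronglyMeasurable.prod_swap.integral_prod_right'
  rw [memLp_two_iff_integrable_sq hm]
  exact (integrable_mul_of_memLp_uncurry hD).integral_prod_right.congr
    (.of_forall fun ω => (integral_prod_mul (fun s => D s ω) (fun s => D s ω)).trans (sq _).symm)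

theorem ae_covariance_eq [SFinite ν] [IsProbabilityMeasure P]
    (h2 : ∀ᵐ s ∂ν, MemLp (D s) 2 P) :
    (fun p : E × E => ∫ ω, D p.1 ω * D p.2 ω ∂P - (∫ ω, D p.1 ω ∂P) * ∫ ω, D p.2 ω ∂P)
      =ᵐ[ν.prod ν] fun p => cov[D p.1, D p.2; P] := by
  filter_upwards [Measure.quasiMeasurePreserving_fst.ae h2,
    Measure.quasiMeasurePreserving_snd.ae h2] with p h1 h2
  exact (covariance_eq_sub h1 h2).symm

theorem integrable_covariance [IsProbabilityMeasure ν] [IsProbabilityMeasure P]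
    (hD : MemLp (Function.uncurry D) 2 (ν.prod P))
    (h2 : ∀ᵐ s ∂ν, MemLp (D s) 2 P) :
    Integrable (fun p : E × E => cov[D p.1, D p.2; P]) (ν.prod ν) := by
  have hi := (hD.integrable one_le_two).integral_prod_left
  exact ((integrable_mul_of_memLp_uncurry hD).integral_prod_left.sub (hi.mul_prod hi)).congr
    (ae_covariance_eq h2)

/-- The variance of an average is the average of the covariances. -/
theorem variance_average [IsProbabilityMeasure ν] [IsProbabilityMeasure P]
    (hD : MemLp (Function.uncurry D) 2 (ν.prod P))
    (h2 : ∀ᵐ s ∂ν, MemLp (D s) 2 P) :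
    Var[fun ω => ∫ s, D s ω ∂ν; P] = ∫ p, cov[D p.1, D p.2; P] ∂ν.prod ν := by
  have hi : Integrable (fun s => ∫ ω, D s ω ∂P) ν := (hD.integrable one_le_two).integral_prod_left
  have hF := integrable_mul_of_memLp_uncurry hD
  rw [variance_eq_sub (memLp_average hD), ← integral_congr_ae (ae_covariance_eq h2),
    integral_sub hF.integral_prod_left (hi.mul_prod hi),
    integral_prod_mul (fun s => ∫ ω, D s ω ∂P) (fun s => ∫ ω, D s ω ∂P), ← sq]
  congr 1
  · simp only [Pi.pow_apply, sq, ← integral_prod_mul]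
    exact (integral_integral_swap hF).symm
  · rw [integral_integral_swap (hD.integrable one_le_two)]

end Averages

/-! ### The isotropic Gaussian process -/

section GaussianField

variable {Ω : Type*} [MeasurableSpace Ω] {P : Measure Ω} {S : Set Plane}
  {X : Plane → Ω → ℝ} {ρ : ℝ → ℝ}

/-- Isotropy: the joint law at two sites depends only on the correlation. -/
theorem IsIsotropicStandardGaussian.map_prodMk (hX : IsIsotropicStandardGaussian P S X ρ)
    {s t : Plane} (hs : s ∈ S) (ht : t ∈ S) :
    P.map (fun ω => (X s ω, X t ω)) = bivariateStdNormal (ρ (dist s t)) :=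
  map_prodMk_eq_bivariateStdNormal
    (hX.gaussian.hasGaussianLaw_prodMk (s := ⟨s, hs⟩) (t := ⟨t, ht⟩))
    (hX.mean_eq_zero s hs) (hX.mean_eq_zero t ht) (hX.variance_eq_one s hs)
    (hX.variance_eq_one t ht) (hX.covariance_eq s hs t ht)

theorem IsIsotropicStandardGaussian.aemeasurable (hX : IsIsotropicStandardGaussian P S X ρ)
    {s : Plane} (hs : s ∈ S) : AEMeasurable (X s) P :=
  hX.gaussian.aemeasurable ⟨s, hs⟩

theorem IsIsotropicStandardGaussian.hasGaussianLaw (hX : IsIsotropicStandardGaussian P S X ρ)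
    {s : Plane} (hs : s ∈ S) : HasGaussianLaw (X s) P :=
  hX.gaussian.hasGaussianLaw_eval ⟨s, hs⟩

theorem IsIsotropicStandardGaussian.map_eq (hX : IsIsotropicStandardGaussian P S X ρ)
    {s : Plane} (hs : s ∈ S) : P.map (X s) = gaussianReal 0 1 := by
  rw [(hX.hasGaussianLaw hs).map_eq_gaussianReal, hX.mean_eq_zero s hs, hX.variance_eq_one s hs,
    Real.toNNReal_one]

theorem memLp_excess_gaussianReal (u : ℝ) :
    MemLp (fun x => max (x - u) 0) 2 (gaussianReal 0 1) :=
  ((memLp_id_gaussianReal 2).sub (memLp_const u)).pos_part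

theorem IsIsotropicStandardGaussian.memLp_excessDamage
    (hX : IsIsotropicStandardGaussian P S X ρ) (u : ℝ) {s : Plane} (hs : s ∈ S) :
    MemLp (excessDamage X u s) 2 P := by
  have h := memLp_excess_gaussianReal u
  rw [← hX.map_eq hs] at h
  exact h.comp_of_map (hX.aemeasurable hs)

theorem IsIsotropicStandardGaussian.integral_excessDamage_sq
    (hX : IsIsotropicStandardGaussian P S X ρ) (u : ℝ) {s : Plane} (hs : s ∈ S) :
    ∫ ω, excessDamage X u s ω ^ 2 ∂P = ∫ x, max (x - u) 0 ^ 2 ∂gaussianReal 0 1 := by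
  rw [← hX.map_eq hs, integral_map (hX.aemeasurable hs) (by fun_prop)]
  rfl

theorem IsIsotropicStandardGaussian.covariance_excessDamage
    (hX : IsIsotropicStandardGaussian P S X ρ) (u : ℝ) {s t : Plane} (hs : s ∈ S) (ht : t ∈ S) :
    cov[excessDamage X u s, excessDamage X u t; P]
      = cov[fun p => max (p.1 - u) 0, fun p => max (p.2 - u) 0;
          bivariateStdNormal (ρ (dist s t))] := by
  rw [← hX.map_prodMk hs ht, covariance_map_fun (by fun_prop) (by fun_prop)
    ((hX.aemeasurable hs).prodMk (hX.aemeasurable ht))]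
  rfl

theorem IsIsotropicStandardGaussian.covariance_eq_excessCov
    (hX : IsIsotropicStandardGaussian P S X ρ) (u : ℝ) {s t : Plane} (hs : s ∈ S) (ht : t ∈ S) :
    cov[excessDamage X u s, excessDamage X u t; P] = excessCov P S X (dist s t) u := by
  have H : ∃ p : Plane × Plane, p.1 ∈ S ∧ p.2 ∈ S ∧ dist p.1 p.2 = dist s t := ⟨(s, t), hs, ht, rfl⟩
  rw [excessCov, dif_pos H, hX.covariance_excessDamage u hs ht,
    hX.covariance_excessDamage u H.choose_spec.1 H.choose_spec.2.1, H.choose_spec.2.2]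

theorem IsIsotropicStandardGaussian.excessCov_eq_formula [IsProbabilityMeasure P]
    (hX : IsIsotropicStandardGaussian P S X ρ) (u : ℝ) {s t : Plane} (hs : s ∈ S) (ht : t ∈ S)
    (hr : |ρ (dist s t)| < 1) :
    excessCov P S X (dist s t) u = excessCovFormula (ρ (dist s t)) u := by
  have hmean : ∀ {x : Plane}, x ∈ S →
      ∫ ω, excessDamage X u x ω ∂P = stdNormalDensity u - u * stdNormalSurvival u := by
    intro x hx
    rw [← integral_excess_gaussianReal, ← hX.map_eq hx, integral_map (hX.aemeasurable hx)
      (by fun_prop)]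
    rfl
  rw [← hX.covariance_eq_excessCov u hs ht, covariance_eq_sub (hX.memLp_excessDamage u hs)
    (hX.memLp_excessDamage u ht), hmean hs, hmean ht, excessCovFormula, ← sq,
    ← integral_excess_mul_excess hr, ← hX.map_prodMk hs ht,
    integral_map ((hX.aemeasurable hs).prodMk (hX.aemeasurable ht)) (by fun_prop)]
  rfl

/-- On a region `A` whose uniform distance law has a density `f` on `[0, M]`, the variance of the
normalized loss is the integral of `𝒢 f`. The path `γ` supplies, measurably in `h`, sites
`γ 0` and `γ h` of `A` at distance `h`; this gives the measurability of `𝒢` on `[0, M]`. -/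
theorem IsIsotropicStandardGaussian.varianceReducesTo [IsProbabilityMeasure P]
    (hX : IsIsotropicStandardGaussian P S X ρ) (u : ℝ) {A : Set Plane} (hA : MeasurableSet A)
    (hAS : A ⊆ S) (hA0 : volume A ≠ 0) (hAt : volume A ≠ ⊤) {M : ℝ} (hM : 0 ≤ M) {f : ℝ → ℝ}
    (hf : Measurable f) (hf0 : ∀ h ∈ Icc 0 M, 0 ≤ f h)
    (hfd : uniformDistanceLaw A =
      (volume.restrict (Icc 0 M)).withDensity (fun h => ENNReal.ofReal (f h)))
    {γ : ℝ → Plane} (hγ : Measurable γ) (hγA : ∀ h ∈ Icc 0 M, γ h ∈ A)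
    (hγd : ∀ h ∈ Icc 0 M, dist (γ 0) (γ h) = h) :
    VarianceReducesTo P S X u A M f := by
  classical
  set ν : Measure Plane := cond volume A with hν
  have : IsProbabilityMeasure ν := cond_isProbabilityMeasure_of_finite hA0 hAt
  have hνA : ∀ᵐ s ∂ν, s ∈ A := ae_cond_mem hA
  -- The damage is cut off outside `A`, where `X` need not be measurable.
  set D : Plane → Ω → ℝ := fun s ω => if s ∈ A then excessDamage X u s ω else 0 with hDdef
  have hDA : ∀ s ∈ A, D s = excessDamage X u s := fun s hs => by ext ω; simp [hDdef, hs]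
  have hDm : Measurable (Function.uncurry D) := by
    refine measurable_of_restrict_of_restrict_compl (hA.prod (MeasurableSet.univ (α := Ω))) ?_ ?_
    · have h1 : Measurable (fun q : (A ×ˢ (univ : Set Ω) : Set (Plane × Ω)) =>
          ((⟨q.1.1, hAS q.2.1⟩ : S), q.1.2)) := by fun_prop
      convert! ((hX.measurable.comp h1).sub_const u).max (measurable_const (a := (0 : ℝ))) using 1
      ext q
      simp [hDdef, Function.uncurry, q.2.1, excessDamage]
    · convert! measurable_const (a := (0 : ℝ)) using 1
      ext q
      have : q.1.1 ∉ A := fun h => q.2 ⟨h, mem_univ _⟩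
      simp [hDdef, Function.uncurry, this]
  have h2 : ∀ᵐ s ∂ν, MemLp (D s) 2 P := hνA.mono fun s hs => by
    rw [hDA s hs]; exact hX.memLp_excessDamage u (hAS hs)
  have hDL : MemLp (Function.uncurry D) 2 (ν.prod P) :=
    memLp_uncurry_of_integral_sq_le hDm h2 (hνA.mono fun s hs => by
      rw [hDA s hs, hX.integral_excessDamage_sq u (hAS hs)])
  have hνeq : ν = (volume A)⁻¹ • volume.restrict A := rfl
  have hloss : excessLoss X u A = fun ω => ∫ s, D s ω ∂ν := by
    ext ω
    rw [excessLoss, normalizedLoss, integral_congr_ae (hνA.mono fun s hs => congrFun (hDA s hs) ω),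
      hνeq, integral_smul_measure, ENNReal.toReal_inv, smul_eq_mul, measureReal_def]
  set G : ℝ → ℝ := fun h => excessCov P S X h u with hG
  have hcov : (fun p : Plane × Plane => cov[D p.1, D p.2; P])
      =ᵐ[ν.prod ν] fun p => G (dist p.1 p.2) := by
    filter_upwards [Measure.quasiMeasurePreserving_fst.ae hνA,
      Measure.quasiMeasurePreserving_snd.ae hνA] with p h1 h2
    rw [hDA _ h1, hDA _ h2, hX.covariance_eq_excessCov u (hAS h1) (hAS h2)]
  have hGm : AEStronglyMeasurable G (volume.restrict (Icc 0 M)) := by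
    refine ⟨fun h => cov[D (γ 0), D (γ h); P], (stronglyMeasurable_covariance hDm).comp_measurable
      (measurable_const.prodMk hγ), ?_⟩
    filter_upwards [ae_restrict_mem measurableSet_Icc] with h hh
    have h0 := hγA 0 ⟨le_rfl, hM⟩
    rw [hDA _ h0, hDA _ (hγA h hh), hX.covariance_eq_excessCov u (hAS h0) (hAS (hγA h hh)),
      hγd h hh]
  have hGm' : AEStronglyMeasurable G (uniformDistanceLaw A) :=
    hGm.mono_ac (hfd ▸ withDensity_absolutelyContinuous _ _)
  have hdm : AEMeasurable (fun p : Plane × Plane => dist p.1 p.2) (ν.prod ν) := by fun_prop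
  have hGi : Integrable G (uniformDistanceLaw A) :=
    (integrable_map_measure hGm' hdm).2 ((integrable_covariance hDL h2).congr hcov)
  have hae : ∀ᵐ h ∂volume.restrict (Icc 0 M), (ENNReal.ofReal (f h)).toReal • G h = G h * f h := by
    filter_upwards [ae_restrict_mem measurableSet_Icc] with h hh
    rw [ENNReal.toReal_ofReal (hf0 h hh), smul_eq_mul, mul_comm]
  refine ⟨?_, ?_, ?_, ?_, hf0, hfd⟩
  · filter_upwards [ae_integrable_of_memLp_uncurry hDL] with ω hω
    rw [integrable_congr (hνA.mono fun s hs => congrFun (hDA s hs) ω), hνeq,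
      integrable_smul_measure (by simpa using hAt) (by simpa using hA0)] at hω
    exact hω
  · rw [hloss]; exact memLp_average hDL
  · rw [intervalIntegrable_iff_integrableOn_Icc_of_le hM]
    rw [hfd, integrable_withDensity_iff_integrable_smul' hf.ennreal_ofReal (by simp)] at hGi
    exact hGi.congr hae
  · rw [hloss, variance_average hDL h2, integral_congr_ae hcov, ← integral_map hdm hGm',
      ← uniformDistanceLaw, hfd, integral_withDensity_eq_integral_toReal_smul hf.ennreal_ofReal
      (by simp), integral_congr_ae hae, intervalIntegral.integral_of_le hM,
      integral_Icc_eq_integral_Ioc]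

end GaussianField

/-! ### Law of the distance of two uniform points -/

/-- The points of `B` that stay in `B` when translated by `z`. -/
def translateOverlap (B : Set ℂ) (z : ℂ) : Set ℂ := {w | w ∈ B ∧ w + z ∈ B}

theorem measurableSet_overlap {B : Set ℂ} (hB : MeasurableSet B) :
    MeasurableSet {q : ℂ × ℂ | q.2 ∈ translateOverlap B q.1} :=
  (measurable_snd hB).inter ((measurable_snd.add measurable_fst) hB)

theorem measurable_volume_translateOverlap {B : Set ℂ} (hB : MeasurableSet B) :
    Measurable (fun z => volume (translateOverlap B z)) :=
  measurable_measure_prodMk_left (measurableSet_overlap hB)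

theorem volume_translateOverlap_le (B : Set ℂ) (z : ℂ) :
    volume (translateOverlap B z) ≤ volume B :=
  measure_mono fun _ h => h.1

/-- Sum over pairs of points at a given difference, then polar coordinates for the difference. -/
theorem lintegral_lintegral_dist {B : Set ℂ} (hB : MeasurableSet B) {g : ℝ → ENNReal}
    (hg : Measurable g) :
    ∫⁻ p in B, ∫⁻ q in B, g (dist p q)
      = ∫⁻ h in Ioi 0, ENNReal.ofReal h * g h *
          ∫⁻ θ in Ioo (-π) π, volume (translateOverlap B (Complex.polarCoord.symm (h, θ))) := by
  have h1 : ∀ p, ∫⁻ q in B, g (dist p q) = ∫⁻ z, g ‖z‖ * B.indicator 1 (p + z) := by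
    intro p
    rw [← lintegral_indicator hB, ← lintegral_add_left_eq_self _ p]
    refine lintegral_congr fun z => ?_
    by_cases h : p + z ∈ B <;> simp [h]
  have hm : Measurable fun q : ℂ × ℂ => g ‖q.2‖ * B.indicator 1 (q.1 + q.2) :=
    (hg.comp (measurable_norm.comp measurable_snd)).mul
      ((measurable_one.indicator hB).comp (measurable_fst.add measurable_snd))
  have hv := measurable_volume_translateOverlap hB
  have hpol : Measurable (fun q : ℝ × ℝ => Complex.polarCoord.symm q) := by
    simp only [Complex.polarCoord_symm_apply]; fun_prop
  calc ∫⁻ p in B, ∫⁻ q in B, g (dist p q)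
      = ∫⁻ p in B, ∫⁻ z, g ‖z‖ * B.indicator 1 (p + z) := lintegral_congr fun p => h1 p
    _ = ∫⁻ z, ∫⁻ p in B, g ‖z‖ * B.indicator 1 (p + z) := lintegral_lintegral_swap hm.aemeasurable
    _ = ∫⁻ z, g ‖z‖ * volume (translateOverlap B z) := by
        refine lintegral_congr fun z => ?_
        have hs : MeasurableSet ((fun p => p + z) ⁻¹' B) := (measurable_add_const z) hB
        have : ∀ p, B.indicator (1 : ℂ → ENNReal) (p + z)
            = ((fun p => p + z) ⁻¹' B).indicator 1 p :=
          fun p => rfl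
        simp_rw [this]
        rw [lintegral_const_mul _ (measurable_one.indicator hs), lintegral_indicator_one hs,
          Measure.restrict_apply hs, inter_comm]
        rfl
    _ = _ := by
        rw [← Complex.lintegral_comp_polarCoord_symm, polarCoord_target, Measure.volume_eq_prod,
          ← Measure.prod_restrict, lintegral_prod _ (by
            simp only [Complex.norm_polarCoord_symm, smul_eq_mul]
            exact (Measurable.mul (by fun_prop) (Measurable.mul (by fun_prop)
              (hv.comp hpol))).aemeasurable)]
        refine setLIntegral_congr_fun measurableSet_Ioi fun h hh => ?_
        simp only [Complex.norm_polarCoord_symm, smul_eq_mul, abs_of_pos (mem_Ioi.1 hh)]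
        have hm : Measurable fun θ =>
            volume (translateOverlap B (Complex.polarCoord.symm (h, θ))) :=
          hv.comp (hpol.comp measurable_prodMk_left)
        rw [← lintegral_const_mul _ hm]
        simp_rw [mul_assoc]

theorem IsometryEquiv.measurePreserving_complex_plane (e : ℂ ≃ᵢ Plane) :
    MeasurePreserving e := by
  have h : ⇑e = (fun x => x + e 0) ∘ e.toRealAffineIsometryEquiv.linearIsometryEquiv := by
    ext1 z
    have := e.toRealAffineIsometryEquiv.map_vadd 0 z
    simpa using this
  rw [h]
  exact (measurePreserving_add_right volume (e 0)).comp (LinearIsometryEquiv.measurePreserving _)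

/-- The distance law of the isometric copy of a planar region, from the areas of the overlaps of the
region with its translates. -/
theorem uniformDistanceLaw_eq_withDensity (e : ℂ ≃ᵢ Plane) {B : Set ℂ} (hB : MeasurableSet B)
    (hB0 : volume B ≠ 0)
    (hBt : volume B ≠ ⊤) {M : ℝ} {f : ℝ → ℝ} (hfm : Measurable f)
    (hf : ∀ h ∈ Ioc 0 M, f h = h / volume.real B ^ 2 *
      ∫ θ in Ioo (-π) π, volume.real (translateOverlap B (Complex.polarCoord.symm (h, θ))))
    (hM : ∀ z : ℂ, M < ‖z‖ → translateOverlap B z = ∅) :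
    uniformDistanceLaw (e '' B) =
      (volume.restrict (Icc 0 M)).withDensity (fun h => ENNReal.ofReal (f h)) := by
  have he := e.measurePreserving_complex_plane
  have heB : MeasurableSet (e '' B) := e.toHomeomorph.measurableEmbedding.measurableSet_image.2 hB
  have hpre : e ⁻¹' (e '' B) = B := e.injective.preimage_image B
  have hvol : volume (e '' B) = volume B := by
    rw [← he.measure_preimage heB.nullMeasurableSet, hpre]
  have hpol : Measurable (fun q : ℝ × ℝ => Complex.polarCoord.symm q) := by
    simp only [Complex.polarCoord_symm_apply]; fun_prop
  have hv := measurable_volume_translateOverlap hB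
  refine Measure.ext_of_lintegral _ fun g hg => ?_
  have hres : ∀ F : Plane → ENNReal, ∫⁻ s in e '' B, F s = ∫⁻ z in B, F (e z) := fun F => by
    rw [← he.setLIntegral_comp_preimage_emb e.toHomeomorph.measurableEmbedding, hpre]
  have hlhs : ∫⁻ h, g h ∂uniformDistanceLaw (e '' B)
      = (volume B)⁻¹ * ((volume B)⁻¹ * ∫⁻ p in B, ∫⁻ q in B, g (dist p q)) := by
    rw [uniformDistanceLaw, lintegral_map hg (by fun_prop), lintegral_prod _ (by fun_prop)]
    simp only [ProbabilityTheory.cond, lintegral_smul_measure, hvol, smul_eq_mul]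
    rw [hres, lintegral_const_mul' _ _ (ENNReal.inv_ne_top.2 hB0)]
    simp_rw [hres, e.dist_eq]
  have hcut : ∀ F : ℝ → ENNReal,
      ∫⁻ h in Ioi 0, F h * ∫⁻ θ in Ioo (-π) π,
          volume (translateOverlap B (Complex.polarCoord.symm (h, θ)))
        = ∫⁻ h in Ioc 0 M, F h * ∫⁻ θ in Ioo (-π) π,
          volume (translateOverlap B (Complex.polarCoord.symm (h, θ))) := by
    intro F
    rw [← lintegral_indicator measurableSet_Ioi, ← lintegral_indicator measurableSet_Ioc]
    refine lintegral_congr fun h => ?_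
    by_cases h0 : 0 < h
    · by_cases h1 : h ≤ M
      · simp [h0, h1]
      · have : ∀ θ, translateOverlap B (Complex.polarCoord.symm (h, θ)) = ∅ := fun θ => hM _ (by
          rw [Complex.norm_polarCoord_symm, abs_of_pos h0]; exact not_le.1 h1)
        simp only [this, measure_empty, lintegral_zero, mul_zero, indicator_apply, ite_self]
    · simp [h0]
  have hreal : ∀ h, ∫⁻ θ in Ioo (-π) π, volume (translateOverlap B (Complex.polarCoord.symm (h, θ)))
      = ENNReal.ofReal (∫ θ in Ioo (-π) π,
          volume.real (translateOverlap B (Complex.polarCoord.symm (h, θ)))) := by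
    intro h
    have hm := hv.comp (hpol.comp (measurable_prodMk_left (x := h)))
    rw [ofReal_integral_eq_lintegral_ofReal]
    · refine lintegral_congr fun θ => (ENNReal.ofReal_toReal ?_).symm
      exact ne_top_of_le_ne_top hBt (volume_translateOverlap_le B _)
    · refine Integrable.of_bound hm.ennreal_toReal.aestronglyMeasurable (volume.real B)
        (.of_forall fun θ => ?_)
      rw [Real.norm_of_nonneg measureReal_nonneg]
      exact ENNReal.toReal_mono hBt (volume_translateOverlap_le B _)
    · exact .of_forall fun θ => ENNReal.toReal_nonneg
  have hV : (volume B)⁻¹ = ENNReal.ofReal (volume.real B)⁻¹ := by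
    rw [measureReal_def, ENNReal.ofReal_inv_of_pos (ENNReal.toReal_pos hB0 hBt),
      ENNReal.ofReal_toReal hBt]
  rw [hlhs, lintegral_lintegral_dist hB hg, hcut, lintegral_withDensity_eq_lintegral_mul _
    hfm.ennreal_ofReal hg, Measure.restrict_congr_set Ioc_ae_eq_Icc.symm,
    ← lintegral_const_mul' _ _ (ENNReal.inv_ne_top.2 hB0),
    ← lintegral_const_mul' _ _ (ENNReal.inv_ne_top.2 hB0)]
  refine setLIntegral_congr_fun measurableSet_Ioc fun h hh => ?_
  have hW : 0 ≤ (volume.real B)⁻¹ := inv_nonneg.2 measureReal_nonneg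
  simp only [Pi.mul_apply]
  rw [hf h hh, hreal, hV, div_eq_mul_inv, ← inv_pow, sq,
    ENNReal.ofReal_mul (mul_nonneg hh.1.le (mul_nonneg hW hW)), ENNReal.ofReal_mul hh.1.le,
    ENNReal.ofReal_mul hW]
  ring

/-! ### Disks -/

/-- For `m < 0` the set is empty and `√m = 0`. -/
theorem volume_setOf_sq_le (m : ℝ) : volume {y : ℝ | y ^ 2 ≤ m} = ENNReal.ofReal (2 * √m) := by
  rcases lt_or_ge m 0 with hm | hm
  · have : {y : ℝ | y ^ 2 ≤ m} = ∅ := by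
      ext y; simp only [mem_ofPred_eq, mem_empty_iff_false, iff_false]; nlinarith [sq_nonneg y]
    rw [this, Real.sqrt_eq_zero_of_nonpos hm.le]; simp
  · have : {y : ℝ | y ^ 2 ≤ m} = Icc (-√m) √m := by
      ext y; simp [Real.sq_le hm]
    rw [this, Real.volume_Icc]; congr 1; ring

/-- For `a ≥ 0`, half the area of the cap cut off from the disk by a chord at distance `a` from the
center; a lens consists of two caps. -/
theorem integral_sqrt_sq_sub_sq {a R : ℝ} (ha : -R ≤ a) (haR : a ≤ R) (hR : 0 < R) :
    ∫ x in a..R, √(R ^ 2 - x ^ 2)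
      = (R ^ 2 * Real.arccos (a / R) - a * √(R ^ 2 - a ^ 2)) / 2 := by
  have hcont : ContinuousOn (fun x => (x * √(R ^ 2 - x ^ 2) - R ^ 2 * Real.arccos (x / R)) / 2)
      (Icc a R) := by
    have := Real.continuous_arccos
    fun_prop
  have h := intervalIntegral.integral_eq_sub_of_hasDerivAt_of_le haR hcont
    (f' := fun x => √(R ^ 2 - x ^ 2)) ?_ (Continuous.intervalIntegrable (by fun_prop) _ _)
  · rw [h]
    simp [div_self hR.ne']
    ring
  · intro x hx
    have hx1 : -R < x := by linarith [hx.1]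
    have hp : 0 < R ^ 2 - x ^ 2 := by nlinarith [hx.2]
    have hs := Real.sqrt_pos.2 hp
    have d1 : HasDerivAt (fun x => √(R ^ 2 - x ^ 2)) (-(2 * x) / (2 * √(R ^ 2 - x ^ 2))) x := by
      have := (((hasDerivAt_id x).pow 2).const_sub (R ^ 2)).sqrt hp.ne'
      simpa using this
    have n1 : x / R ≠ -1 := by rw [ne_eq, div_eq_iff hR.ne']; linarith
    have n2 : x / R ≠ 1 := by rw [ne_eq, div_eq_iff hR.ne']; linarith [hx.2]
    have d2 : HasDerivAt (fun x => Real.arccos (x / R)) (-(1 / √(1 - (x / R) ^ 2)) * (1 / R)) x :=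
      HasDerivAt.comp (h₂ := Real.arccos) (h := fun x => x / R) x (Real.hasDerivAt_arccos n1 n2)
        ((hasDerivAt_id x).div_const R)
    have e : √(1 - (x / R) ^ 2) = √(R ^ 2 - x ^ 2) / R := by
      rw [← Real.sqrt_sq hR.le, ← Real.sqrt_div' _ (by positivity), Real.sqrt_sq hR.le]
      congr 1; field_simp
    convert! (((hasDerivAt_id x).mul d1).sub (d2.const_mul (R ^ 2))).div_const 2 using 1
    rw [e]
    field_simp
    simp only [id]
    rw [Real.sq_sqrt hp.le]
    ring

/-- The area of the lens common to two disks of radius `R` with centers at distance `h`. -/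
theorem volume_translateOverlap_closedBall_ofReal {h R : ℝ} (hh : 0 ≤ h) (hR : 0 < R)
    (hhR : h ≤ 2 * R) :
    volume.real (translateOverlap (Metric.closedBall 0 R) (h : ℂ))
      = 2 * R ^ 2 * Real.arccos (h / (2 * R)) - h * R * √(1 - h ^ 2 / (4 * R ^ 2)) := by
  set T : Set (ℝ × ℝ) := {q | q.2 ^ 2 ≤ R ^ 2 - max (q.1 ^ 2) ((q.1 + h) ^ 2)} with hT
  have hTm : MeasurableSet T := measurableSet_le (by fun_prop) (by fun_prop)
  have hpre : translateOverlap (Metric.closedBall 0 R) (h : ℂ)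
      = Complex.measurableEquivRealProd ⁻¹' T := by
    ext z
    have : ∀ w : ℂ, ‖w‖ ≤ R ↔ w.re ^ 2 + w.im ^ 2 ≤ R ^ 2 := fun w => by
      rw [← sq_le_sq₀ (norm_nonneg w) hR.le, Complex.sq_norm, Complex.normSq_apply, ← sq, ← sq]
    simp only [translateOverlap, mem_ofPred_eq, mem_closedBall_zero_iff, this, hT, mem_preimage,
      Complex.measurableEquivRealProd_apply, Complex.add_re, Complex.add_im, Complex.ofReal_re,
      Complex.ofReal_im, add_zero]
    rw [le_sub_comm, max_le_iff, le_sub_iff_add_le, le_sub_iff_add_le]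
  have hvol : volume (translateOverlap (Metric.closedBall 0 R) (h : ℂ))
      = ∫⁻ x, ENNReal.ofReal (2 * √(R ^ 2 - (|x| + h / 2) ^ 2)) := by
    rw [hpre, Complex.volume_preserving_equiv_real_prod.measure_preimage hTm.nullMeasurableSet,
      Measure.volume_eq_prod, Measure.prod_apply hTm, ← lintegral_add_right_eq_self _ (-(h / 2))]
    refine lintegral_congr fun x => ?_
    -- After centering the two disks at `±h / 2`, the farther center is at abscissa distance
    -- `|x| + h / 2`.
    have : max ((x + -(h / 2)) ^ 2) ((x + -(h / 2) + h) ^ 2) = (|x| + h / 2) ^ 2 := by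
      rcases abs_cases x with ⟨hx, h0⟩ | ⟨hx, h0⟩
      · rw [hx, max_eq_right (by nlinarith)]; ring
      · rw [hx, max_eq_left (by nlinarith)]; ring
    rw [← this, ← volume_setOf_sq_le]
    rfl
  -- Beyond the disk the radicand is negative, so that the square root vanishes.
  have hsupp : ∫ x in Ioi (0 : ℝ), √(R ^ 2 - (x + h / 2) ^ 2)
      = ∫ x in (h / 2)..R, √(R ^ 2 - x ^ 2) := by
    rw [intervalIntegral.integral_of_le (by linarith), ← integral_indicator measurableSet_Ioi,
      ← integral_indicator measurableSet_Ioc]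
    conv_rhs => rw [← integral_add_right_eq_self _ (h / 2)]
    refine integral_congr_ae (.of_forall fun x => ?_)
    by_cases hx : 0 < x
    · by_cases hxR : x + h / 2 ≤ R
      · simp [hx, hxR]
      · have : R ^ 2 - (x + h / 2) ^ 2 ≤ 0 := by nlinarith
        simp [hx, hxR, Real.sqrt_eq_zero_of_nonpos this]
    · simp [hx]
  rw [measureReal_def, hvol, ← integral_eq_lintegral_of_nonneg_ae
    (.of_forall fun x => by positivity) (Continuous.aestronglyMeasurable (by fun_prop)),
    integral_comp_abs (f := fun x => 2 * √(R ^ 2 - (x + h / 2) ^ 2)), integral_const_mul, hsupp,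
    integral_sqrt_sq_sub_sq (by linarith) (by linarith) hR]
  have e : R * √(1 - h ^ 2 / (4 * R ^ 2)) = √(R ^ 2 - (h / 2) ^ 2) := by
    rw [← Real.sqrt_sq hR.le, ← Real.sqrt_mul (by positivity), Real.sqrt_sq hR.le]
    congr 1; field_simp; ring
  rw [← e, div_div]
  ring

theorem volume_translateOverlap_closedBall {h R : ℝ} (hh : 0 ≤ h) (hR : 0 < R)
    (hhR : h ≤ 2 * R) (θ : ℝ) :
    volume.real (translateOverlap (Metric.closedBall 0 R) (Complex.polarCoord.symm (h, θ)))
      = 2 * R ^ 2 * Real.arccos (h / (2 * R)) - h * R * √(1 - h ^ 2 / (4 * R ^ 2)) := by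
  rw [← volume_translateOverlap_closedBall_ofReal hh hR hhR]
  have hrot := (rotation (Circle.exp θ)).measurePreserving
  have hz : Complex.polarCoord.symm (h, θ) = rotation (Circle.exp θ) (h : ℂ) := by
    rw [Complex.polarCoord_symm_apply, rotation_apply, Circle.coe_exp, Complex.exp_mul_I, mul_comm]
    simp
  have hpre : rotation (Circle.exp θ) ⁻¹'
      translateOverlap (Metric.closedBall 0 R) (Complex.polarCoord.symm (h, θ))
        = translateOverlap (Metric.closedBall 0 R) (h : ℂ) := by
    ext w
    simp only [translateOverlap, mem_preimage, mem_ofPred_eq, mem_closedBall_zero_iff, hz,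
      ← map_add, LinearIsometryEquiv.norm_map]
  rw [← hpre, measureReal_def, measureReal_def, hrot.measure_preimage]
  exact (measurable_prodMk_left (measurableSet_overlap
    Metric.isClosed_closedBall.measurableSet)).nullMeasurableSet

theorem measureReal_complex_closedBall {R : ℝ} (hR : 0 ≤ R) :
    volume.real (Metric.closedBall (0 : ℂ) R) = π * R ^ 2 := by
  rw [measureReal_def, Complex.volume_closedBall, ENNReal.toReal_mul, ENNReal.toReal_pow,
    ENNReal.toReal_ofReal hR, mul_comm]
  rfl

theorem fDisk_eq {h R : ℝ} (hR : 0 < R) (hh : h ∈ Icc 0 (2 * R)) :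
    fDisk h R = h / volume.real (Metric.closedBall (0 : ℂ) R) ^ 2 * ∫ θ in Ioo (-π) π,
      volume.real (translateOverlap (Metric.closedBall 0 R) (Complex.polarCoord.symm (h, θ))) := by
  simp_rw [volume_translateOverlap_closedBall hh.1 hR hh.2, measureReal_complex_closedBall hR.le]
  rw [setIntegral_const, Real.volume_real_Ioo_of_le (by linarith [Real.pi_pos]), smul_eq_mul, fDisk]
  have := Real.pi_pos
  field_simp
  ring

theorem measurable_fDisk (R : ℝ) : Measurable (fun h => fDisk h R) := by
  have := Real.continuous_arccos
  have : Continuous (fun h => fDisk h R) := by unfold fDisk; fun_prop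
  exact this.measurable

/-- The isometry of `ℂ` with the plane that sends the origin to `c`. -/
noncomputable def complexIsometryAt (c : Plane) : ℂ ≃ᵢ Plane :=
  Complex.orthonormalBasisOneI.repr.toIsometryEquiv.trans (IsometryEquiv.addRight c)

theorem complexIsometryAt_apply (c : Plane) (z : ℂ) :
    complexIsometryAt c z = Complex.orthonormalBasisOneI.repr z + c := rfl

theorem complexIsometryAt_image_closedBall (c : Plane) (R : ℝ) :
    complexIsometryAt c '' Metric.closedBall 0 R = Metric.closedBall c R := by
  rw [IsometryEquiv.image_closedBall, complexIsometryAt_apply, map_zero, zero_add]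

theorem uniformDistanceLaw_closedBall (c : Plane) {R : ℝ} (hR : 0 < R) :
    uniformDistanceLaw (Metric.closedBall c R) =
      (volume.restrict (Icc 0 (2 * R))).withDensity (fun h => ENNReal.ofReal (fDisk h R)) := by
  rw [← complexIsometryAt_image_closedBall]
  refine uniformDistanceLaw_eq_withDensity _ Metric.isClosed_closedBall.measurableSet
    (Metric.measure_closedBall_pos _ _ hR).ne' measure_closedBall_lt_top.ne (measurable_fDisk R)
    (fun h hh => fDisk_eq hR (Ioc_subset_Icc_self hh)) fun z hz => ?_
  refine eq_empty_of_forall_notMem fun w hw => ?_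
  have h1 := mem_closedBall_zero_iff.1 hw.1
  have h2 := mem_closedBall_zero_iff.1 hw.2
  have h3 := norm_sub_le (w + z) w
  rw [add_sub_cancel_left] at h3
  linarith

theorem fDisk_nonneg {h R : ℝ} (hR : 0 < R) (hh : h ∈ Icc 0 (2 * R)) : 0 ≤ fDisk h R := by
  rw [fDisk_eq hR hh]
  exact mul_nonneg (div_nonneg hh.1 (sq_nonneg _)) (integral_nonneg fun _ => measureReal_nonneg)

/-! ### Squares -/

/-- The square `[0, R]²` in the complex plane. -/
def complexSquare (R : ℝ) : Set ℂ := {z | z.re ∈ Icc 0 R ∧ z.im ∈ Icc 0 R}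

theorem measurableSet_complexSquare (R : ℝ) : MeasurableSet (complexSquare R) :=
  (Complex.measurable_re measurableSet_Icc).inter (Complex.measurable_im measurableSet_Icc)

theorem volume_setOf_re_im {s t : Set ℝ} (hs : MeasurableSet s) (ht : MeasurableSet t) :
    volume {z : ℂ | z.re ∈ s ∧ z.im ∈ t} = volume s * volume t := by
  have : {z : ℂ | z.re ∈ s ∧ z.im ∈ t} = Complex.measurableEquivRealProd ⁻¹' (s ×ˢ t) := by
    ext z; simp
  rw [this, Complex.volume_preserving_equiv_real_prod.measure_preimage
    (hs.prod ht).nullMeasurableSet, Measure.volume_eq_prod, Measure.prod_prod]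

theorem volume_complexSquare {R : ℝ} (hR : 0 ≤ R) :
    volume (complexSquare R) = ENNReal.ofReal (R ^ 2) := by
  rw [complexSquare, volume_setOf_re_im measurableSet_Icc measurableSet_Icc, Real.volume_Icc,
    sub_zero, ← ENNReal.ofReal_mul hR, sq]

theorem volume_translateOverlap_complexSquare (R : ℝ) (z : ℂ) :
    volume.real (translateOverlap (complexSquare R) z)
      = max (R - |z.re|) 0 * max (R - |z.im|) 0 := by
  have h1 : ∀ a : ℝ, volume (Icc (max 0 (-a)) (min R (R - a))) = ENNReal.ofReal (R - |a|) := by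
    intro a
    rw [Real.volume_Icc]
    congr 1
    rcases abs_cases a with ⟨ha, h0⟩ | ⟨ha, h0⟩
    · rw [ha, max_eq_left (by linarith), min_eq_right (by linarith)]; ring
    · rw [ha, max_eq_right (by linarith), min_eq_left (by linarith)]
  have h2 : translateOverlap (complexSquare R) z
      = {w : ℂ | w.re ∈ Icc (max 0 (-z.re)) (min R (R - z.re)) ∧
          w.im ∈ Icc (max 0 (-z.im)) (min R (R - z.im))} := by
    ext w
    simp only [translateOverlap, complexSquare, mem_ofPred_eq, mem_Icc, Complex.add_re,
      Complex.add_im, max_le_iff, le_min_iff, le_sub_iff_add_le, neg_le_iff_add_nonneg]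
    tauto
  rw [measureReal_def, h2, volume_setOf_re_im measurableSet_Icc measurableSet_Icc, h1, h1,
    ENNReal.toReal_mul, ENNReal.toReal_ofReal', ENNReal.toReal_ofReal']

/-- The area of overlap of the square with its translate by `h e^{iθ}` is `π / 2`-periodic in `θ`,
so that its angular integral is four times that over the first quadrant. -/
theorem integral_volume_translateOverlap_complexSquare {h R : ℝ} (hh : 0 ≤ h) :
    ∫ θ in Ioo (-π) π, volume.real
        (translateOverlap (complexSquare R) (Complex.polarCoord.symm (h, θ)))
      = 4 * ∫ θ in (0 : ℝ)..(π / 2),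
          max (R - h * Real.cos θ) 0 * max (R - h * Real.sin θ) 0 := by
  set F : ℝ → ℝ := fun θ => max (R - h * |Real.cos θ|) 0 * max (R - h * |Real.sin θ|) 0 with hF
  have h1 : ∀ θ, volume.real (translateOverlap (complexSquare R) (Complex.polarCoord.symm (h, θ)))
      = F θ := by
    intro θ
    rw [volume_translateOverlap_complexSquare, Complex.polarCoord_symm_apply]
    simp only [Complex.re_ofReal_mul, Complex.im_ofReal_mul, abs_mul, abs_of_nonneg hh, hF]
    simp [-Complex.ofReal_cos, -Complex.ofReal_sin]
  have hper : Function.Periodic F (π / 2) := fun θ => by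
    simp only [hF, Real.cos_add_pi_div_two, Real.sin_add_pi_div_two, abs_neg]
    exact mul_comm _ _
  have hc : Continuous F := by fun_prop
  have h2 := hper.intervalIntegral_add_zsmul_eq 4 (-π) fun _ _ => hc.intervalIntegrable _ _
  rw [hper.intervalIntegral_add_eq (-π) 0, zero_add,
    show -π + (4 : ℤ) • (π / 2) = π by simp only [zsmul_eq_mul]; push_cast; ring] at h2
  simp_rw [h1]
  rw [← integral_Ioc_eq_integral_Ioo, ← intervalIntegral.integral_of_le (by linarith [Real.pi_pos]),
    h2, zsmul_eq_mul, Int.cast_ofNat]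
  congr 1
  refine intervalIntegral.integral_congr fun θ hθ => ?_
  rw [uIcc_of_le (by positivity)] at hθ
  simp only [hF]
  rw [abs_of_nonneg (Real.cos_nonneg_of_mem_Icc ⟨by linarith [hθ.1, Real.pi_pos], hθ.2⟩),
    abs_of_nonneg (Real.sin_nonneg_of_nonneg_of_le_pi hθ.1 (by linarith [hθ.2, Real.pi_pos]))]

theorem integral_sub_cos_mul_sub_sin (h R a b : ℝ) :
    ∫ θ in a..b, (R - h * Real.cos θ) * (R - h * Real.sin θ)
      = (R ^ 2 * b - R * h * (Real.sin b - Real.cos b) + h ^ 2 * Real.sin b ^ 2 / 2)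
        - (R ^ 2 * a - R * h * (Real.sin a - Real.cos a) + h ^ 2 * Real.sin a ^ 2 / 2) := by
  refine intervalIntegral.integral_eq_sub_of_hasDerivAt (f := fun θ =>
    R ^ 2 * θ - R * h * (Real.sin θ - Real.cos θ) + h ^ 2 * Real.sin θ ^ 2 / 2) (fun θ _ => ?_)
    (Continuous.intervalIntegrable (by fun_prop) _ _)
  have hs := Real.hasDerivAt_sin θ
  convert! (((hasDerivAt_id θ).const_mul (R ^ 2)).sub
    ((hs.sub (Real.hasDerivAt_cos θ)).const_mul (R * h))).add
    (((hs.pow 2).const_mul (h ^ 2)).div_const 2) using 1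
  push_cast
  ring

theorem integral_overlap_near {h R : ℝ} (hh : 0 ≤ h) (hhR : h ≤ R) :
    ∫ θ in (0 : ℝ)..(π / 2), max (R - h * Real.cos θ) 0 * max (R - h * Real.sin θ) 0
      = R ^ 2 * (π / 2) - 2 * R * h + h ^ 2 / 2 := by
  have : ∀ θ, max (R - h * Real.cos θ) 0 * max (R - h * Real.sin θ) 0
      = (R - h * Real.cos θ) * (R - h * Real.sin θ) := fun θ => by
    rw [max_eq_left (by nlinarith [Real.cos_le_one θ]),
      max_eq_left (by nlinarith [Real.sin_le_one θ])]
  simp_rw [this, integral_sub_cos_mul_sub_sin]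
  simp
  ring

/-- For `h > R` the overlap is nonempty only for angles between `arccos (R / h)` and its
complement. -/
theorem integral_overlap_far {h R : ℝ} (hR : 0 < R) (hhR : R ≤ h) (hh2 : h ≤ √2 * R) :
    ∫ θ in (0 : ℝ)..(π / 2), max (R - h * Real.cos θ) 0 * max (R - h * Real.sin θ) 0
      = R ^ 2 * (π / 2 - 2 * Real.arccos (R / h)) - R ^ 2 + 2 * R * √(h ^ 2 - R ^ 2)
        - h ^ 2 / 2 := by
  have hh : 0 < h := hR.trans_le hhR
  have hπ := Real.pi_pos
  set α := Real.arccos (R / h) with hα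
  have hRh1 : R / h ≤ 1 := (div_le_one hh).2 hhR
  have hRh0 : 0 ≤ R / h := by positivity
  have hcos : Real.cos α = R / h := Real.cos_arccos (by linarith) hRh1
  have hsin : h * Real.sin α = √(h ^ 2 - R ^ 2) := by
    rw [hα, Real.sin_arccos, ← Real.sqrt_sq hh.le, ← Real.sqrt_mul (by positivity),
      Real.sqrt_sq hh.le]
    congr 1; field_simp
  have hα0 : 0 ≤ α := Real.arccos_nonneg _
  have hα4 : α ≤ π / 4 := by
    have : Real.arccos (√2 / 2) = π / 4 := by
      rw [← Real.cos_pi_div_four, Real.arccos_cos (by positivity) (by linarith)]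
    rw [← this]
    refine Real.arccos_le_arccos ?_
    rw [le_div_iff₀ hh]
    nlinarith [Real.sq_sqrt (zero_le_two (α := ℝ)), Real.sqrt_nonneg 2]
  have hcR : h * Real.cos α = R := by rw [hcos]; field_simp
  have hint : ∀ a b, IntervalIntegrable
      (fun θ => max (R - h * Real.cos θ) 0 * max (R - h * Real.sin θ) 0) volume a b :=
    fun a b => Continuous.intervalIntegrable (by fun_prop) _ _
  have e1 : ∫ θ in (0 : ℝ)..α, max (R - h * Real.cos θ) 0 * max (R - h * Real.sin θ) 0 = 0 := by
    rw [intervalIntegral.integral_congr (g := fun _ => 0), intervalIntegral.integral_zero]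
    intro θ hθ
    rw [uIcc_of_le hα0] at hθ
    have := Real.cos_le_cos_of_nonneg_of_le_pi hθ.1 (by linarith) hθ.2
    have : R - h * Real.cos θ ≤ 0 := by nlinarith
    simp [max_eq_right this]
  have e3 : ∫ θ in (π / 2 - α)..(π / 2),
      max (R - h * Real.cos θ) 0 * max (R - h * Real.sin θ) 0 = 0 := by
    rw [intervalIntegral.integral_congr (g := fun _ => 0), intervalIntegral.integral_zero]
    intro θ hθ
    rw [uIcc_of_le (by linarith)] at hθ
    have := Real.cos_le_cos_of_nonneg_of_le_pi (x := π / 2 - θ) (y := α) (by linarith [hθ.2])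
      (by linarith) (by linarith [hθ.1])
    rw [Real.cos_pi_div_two_sub] at this
    have : R - h * Real.sin θ ≤ 0 := by nlinarith
    simp [max_eq_right this]
  have e2 : ∫ θ in α..(π / 2 - α), max (R - h * Real.cos θ) 0 * max (R - h * Real.sin θ) 0
      = ∫ θ in α..(π / 2 - α), (R - h * Real.cos θ) * (R - h * Real.sin θ) := by
    refine intervalIntegral.integral_congr fun θ hθ => ?_
    rw [uIcc_of_le (by linarith)] at hθ
    have h1 := Real.cos_le_cos_of_nonneg_of_le_pi hα0 (by linarith [hθ.2]) hθ.1
    have h2 := Real.cos_le_cos_of_nonneg_of_le_pi (x := α) (y := π / 2 - θ) hα0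
      (by linarith [hθ.1]) (by linarith [hθ.2])
    rw [Real.cos_pi_div_two_sub] at h2
    rw [max_eq_left (by nlinarith), max_eq_left (by nlinarith)]
  rw [← intervalIntegral.integral_add_adjacent_intervals (hint 0 α) (hint α _),
    ← intervalIntegral.integral_add_adjacent_intervals (hint α (π / 2 - α)) (hint _ _), e1, e2, e3,
    integral_sub_cos_mul_sub_sin, Real.sin_pi_div_two_sub, Real.cos_pi_div_two_sub, ← hsin]
  have hsc := Real.sin_sq_add_cos_sq α
  linear_combination (-2 * R + (h * Real.cos α + R) ) * hcR - h ^ 2 / 2 * hsc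

/-- For `h ≤ √2 R` this is the length of the interval of angles in the first quadrant at which the
overlap is nonempty. -/
theorem arcsin_eq_pi_div_two_sub {h R : ℝ} (hR : 0 < R) (hhR : R ≤ h) :
    Real.arcsin ((2 - h ^ 2 / R ^ 2) / (h ^ 2 / R ^ 2)) = π / 2 - 2 * Real.arccos (R / h) := by
  have hh : 0 < h := hR.trans_le hhR
  have hRh1 : R / h ≤ 1 := (div_le_one hh).2 hhR
  have hRh0 : 0 ≤ R / h := by positivity
  have h1 : (2 - h ^ 2 / R ^ 2) / (h ^ 2 / R ^ 2)
      = Real.sin (π / 2 - 2 * Real.arccos (R / h)) := by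
    rw [Real.sin_pi_div_two_sub, Real.cos_two_mul, Real.cos_arccos (by linarith) hRh1]
    field_simp
  have h2 := Real.arccos_le_pi_div_two.2 hRh0
  have h3 := Real.arccos_nonneg (R / h)
  rw [h1, Real.arcsin_sin (by linarith) (by linarith)]

/-- The terms of `fSquareFar` with denominator `√(b - 1)` combine to a further `√(b - 1)`. -/
theorem fSquareFar_eq {h R : ℝ} (hR : 0 < R) (hhR : R < h) :
    fSquareFar h R (h ^ 2 / R ^ 2) = 4 * h / R ^ 4 *
      (R ^ 2 * (π / 2 - 2 * Real.arccos (R / h)) - R ^ 2 + 2 * R * √(h ^ 2 - R ^ 2)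
        - h ^ 2 / 2) := by
  have hp : 0 < h ^ 2 - R ^ 2 := by nlinarith
  rw [fSquareFar, arcsin_eq_pi_div_two_sub hR hhR.le]
  obtain ⟨b, hb⟩ : ∃ b, b = h ^ 2 / R ^ 2 := ⟨_, rfl⟩
  rw [← hb]
  have hb1 : b - 1 = (h ^ 2 - R ^ 2) / R ^ 2 := by rw [hb]; field_simp
  have hb0 : 0 < b - 1 := by rw [hb1]; positivity
  have hbp : 0 < b := by linarith
  set s := √(b - 1) with hs
  have hs0 : 0 < s := Real.sqrt_pos.2 hb0
  have hss : s ^ 2 = b - 1 := Real.sq_sqrt hb0.le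
  have e1 : √(h ^ 2 - R ^ 2) = R * s := by
    rw [hs, hb1, Real.sqrt_div' _ (by positivity), Real.sqrt_sq hR.le]
    field_simp
  have e2 : b * √(1 - (2 - b) ^ 2 / b ^ 2) = 2 * s := by
    have : 1 - (2 - b) ^ 2 / b ^ 2 = (2 * s / b) ^ 2 := by
      rw [div_pow, mul_pow, hss]; field_simp; ring
    rw [this, Real.sqrt_sq (by positivity)]
    field_simp
  have e3 : (b + 1) / s - 4 / (2 * s) = s := by
    field_simp
    rw [hss]; ring
  have e4 : h ^ 2 = b * R ^ 2 := by rw [hb]; field_simp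
  rw [e2, e1, show ∀ x y z w v : ℝ, x + y + z + w - v = x + y + w + (z - v) by intros; ring, e3, e4]
  field_simp
  ring

theorem fSquare_eq {h R : ℝ} (hR : 0 < R) (hh : h ∈ Icc 0 (√2 * R)) :
    fSquare h R = h / volume.real (complexSquare R) ^ 2 * ∫ θ in Ioo (-π) π,
      volume.real (translateOverlap (complexSquare R) (Complex.polarCoord.symm (h, θ))) := by
  rw [integral_volume_translateOverlap_complexSquare hh.1, measureReal_def,
    volume_complexSquare hR.le, ENNReal.toReal_ofReal (sq_nonneg R), fSquare]
  split_ifs with hhR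
  · rw [integral_overlap_near hh.1 hhR]
    field_simp
    ring
  · rw [integral_overlap_far hR (not_le.1 hhR).le hh.2, fSquareFar_eq hR (not_le.1 hhR)]
    field_simp

theorem measurable_fSquare (R : ℝ) : Measurable (fun h => fSquare h R) := by
  unfold fSquare fSquareFar
  have := Real.measurable_arcsin
  exact Measurable.ite measurableSet_Iic (by fun_prop) (by fun_prop)

theorem fSquare_nonneg {h R : ℝ} (hR : 0 < R) (hh : h ∈ Icc 0 (√2 * R)) : 0 ≤ fSquare h R := by
  rw [fSquare_eq hR hh]
  exact mul_nonneg (div_nonneg hh.1 (sq_nonneg _)) (integral_nonneg fun _ => measureReal_nonneg)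

theorem uniformDistanceLaw_image_complexSquare (e : ℂ ≃ᵢ Plane) {R : ℝ} (hR : 0 < R) :
    uniformDistanceLaw (e '' complexSquare R) =
      (volume.restrict (Icc 0 (√2 * R))).withDensity (fun h => ENNReal.ofReal (fSquare h R)) := by
  refine uniformDistanceLaw_eq_withDensity _ (measurableSet_complexSquare R) ?_ ?_
    (measurable_fSquare R) (fun h hh => fSquare_eq hR (Ioc_subset_Icc_self hh)) fun z hz => ?_
  · rw [volume_complexSquare hR.le]; simpa using hR.ne'
  · rw [volume_complexSquare hR.le]; exact ENNReal.ofReal_ne_top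
  refine eq_empty_of_forall_notMem fun w hw => ?_
  obtain ⟨⟨⟨h1, h2⟩, h3, h4⟩, ⟨h5, h6⟩, h7, h8⟩ := hw
  rw [Complex.add_re] at h5 h6
  rw [Complex.add_im] at h7 h8
  have h9 : (√2 * R) ^ 2 < ‖z‖ ^ 2 := pow_lt_pow_left₀ hz (by positivity) two_ne_zero
  rw [Complex.sq_norm, Complex.normSq_apply, mul_pow, Real.sq_sqrt zero_le_two] at h9
  nlinarith

theorem image_complexSquare (φ : Plane ≃ᵢ Plane) (R : ℝ) :
    ((complexIsometryAt 0).trans φ) '' complexSquare R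
      = φ '' {x | ∀ i, x i ∈ Icc 0 R} := by
  have : complexIsometryAt 0 '' complexSquare R = {x : Plane | ∀ i, x i ∈ Icc 0 R} := by
    ext x
    constructor
    · rintro ⟨z, hz, rfl⟩ i
      fin_cases i
      · simpa [complexIsometryAt_apply] using hz.1
      · simpa [complexIsometryAt_apply] using hz.2
    · intro hx
      refine ⟨⟨x 0, x 1⟩, ⟨hx 0, hx 1⟩, ?_⟩
      ext i
      fin_cases i <;> simp [complexIsometryAt_apply]
  rw [← this, ← image_comp]
  rfl

/-! ### The variance formulas -/

theorem mainTheorem2 {Ω : Type*} [MeasurableSpace Ω] (P : Measure Ω) [IsProbabilityMeasure P]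
    (S : Set Plane) (X : Plane → Ω → ℝ) (ρ : ℝ → ℝ)
    (hX : IsIsotropicStandardGaussian P S X ρ) (u : ℝ) (hu : 0 ≤ u) :
    -- the function `𝒢`: it is the covariance function of the excess damage, with its closed form
    (∀ s ∈ S, ∀ t ∈ S,
      cov[excessDamage X u s, excessDamage X u t; P] = excessCov P S X (dist s t) u ∧
      (|ρ (dist s t)| < 1 →
        excessCov P S X (dist s t) u = excessCovFormula (ρ (dist s t)) u)) ∧
    -- disks of radius `R`
    (∀ (R : ℝ) (c : Plane), 0 < R → Metric.closedBall c R ⊆ S →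
      VarianceReducesTo P S X u (Metric.closedBall c R) (2 * R) (fun h => fDisk h R)) ∧
    -- squares of side `R`
    (∀ (R : ℝ) (A : Set Plane), 0 < R → IsSquareOfSide A R → A ⊆ S →
      VarianceReducesTo P S X u A (√2 * R) (fun h => fSquare h R)) := by
  refine ⟨fun s hs t ht => ⟨hX.covariance_eq_excessCov u hs ht, hX.excessCov_eq_formula u hs ht⟩,
    fun R c hR hcS => ?_, ?_⟩
  · -- The pairs of sites run along a diameter.
    refine hX.varianceReducesTo u Metric.isClosed_closedBall.measurableSet hcS
      (Metric.measure_closedBall_pos _ _ hR).ne' measure_closedBall_lt_top.ne (by positivity)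
      (measurable_fDisk R) (fun h hh => fDisk_nonneg hR hh) (uniformDistanceLaw_closedBall c hR)
      (γ := fun h => complexIsometryAt c ((h - R : ℝ) : ℂ))
      ((complexIsometryAt c).continuous.measurable.comp (by fun_prop)) (fun h hh => ?_)
      fun h hh => ?_
    · rw [← complexIsometryAt_image_closedBall]
      refine mem_image_of_mem _ ?_
      rw [mem_closedBall_zero_iff, Complex.norm_real, Real.norm_eq_abs, abs_le]
      constructor <;> linarith [hh.1, hh.2]
    · rw [IsometryEquiv.dist_eq, Complex.dist_eq, ← Complex.ofReal_sub, Complex.norm_real,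
        Real.norm_eq_abs, zero_sub, show -R - (h - R) = -h by ring, abs_neg, abs_of_nonneg hh.1]
  · rintro R A hR ⟨φ, rfl⟩ hAS
    rw [← image_complexSquare φ R] at hAS ⊢
    set e := (complexIsometryAt 0).trans φ
    have he := e.measurePreserving_complex_plane
    have hm : MeasurableSet (e '' complexSquare R) :=
      e.toHomeomorph.measurableEmbedding.measurableSet_image.2 (measurableSet_complexSquare R)
    have hvol : volume (e '' complexSquare R) = ENNReal.ofReal (R ^ 2) := by
      rw [← he.measure_preimage hm.nullMeasurableSet, e.injective.preimage_image,
        volume_complexSquare hR.le]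
    have h2 : 0 < √2 := by positivity
    -- The pairs of sites run along a diagonal.
    refine hX.varianceReducesTo u hm hAS (by rw [hvol]; simpa using hR.ne')
      (by rw [hvol]; exact ENNReal.ofReal_ne_top) (by positivity) (measurable_fSquare R)
      (fun h hh => fSquare_nonneg hR hh) (uniformDistanceLaw_image_complexSquare e hR)
      (γ := fun h => e (((h / √2 : ℝ) : ℂ) * (1 + Complex.I)))
      (e.continuous.measurable.comp (by fun_prop)) (fun h hh => ?_) fun h hh => ?_
    · refine mem_image_of_mem _ ?_
      have h3 : 0 ≤ h / √2 := div_nonneg hh.1 h2.le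
      have h4 : h / √2 ≤ R := by rw [div_le_iff₀ h2, mul_comm]; exact hh.2
      refine ⟨?_, ?_⟩
      · rw [Complex.re_ofReal_mul]; simpa using ⟨h3, h4⟩
      · rw [Complex.im_ofReal_mul]; simpa using ⟨h3, h4⟩
    · have h5 : ‖(1 + Complex.I : ℂ)‖ = √2 := by
        rw [Complex.norm_def, Complex.normSq_apply]; norm_num
      rw [e.dist_eq, Complex.dist_eq, zero_div, Complex.ofReal_zero, zero_mul, zero_sub, norm_neg,
        norm_mul, h5, Complex.norm_real, Real.norm_of_nonneg (div_nonneg hh.1 h2.le)]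
      field_simp
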